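/- Let $mS^1=S^1_1\sqcup\dots\sqcup S^1_m$ be a disjoint union of $m$ circles and $I=[0,1]$. Definitions. A PL (topological) link is a PL (topological) embedding $mS^1\to\mathbb R^3$. A TOP isotopy is a homotopy $h_t\colon mS^1\to\mathbb R^3$, $t\in I$, through one-to-one continuous maps. A generic PL homotopy is a PL map $mS^1\times I\to\mathbb R^3$, $(p,t)\mapsto l_t(p)$, such that $l_0$ and $l_1$ are embeddings, $l_t$ is an embedding for all but finitely many $t$, and each singular $l_t$ has precisely one double point, with exactly two preimages $p\ne q$; moreover the track $(p,t)\mapsto(l_t(p),t)$ is affine near $(p,t)$ and near $(q,t)$, and these two sheets cross transversely in $\mathbb R^3\times I$. For $k\in\mathbb N$ (including $k=0$), a PL map $f\colon mS^1\to\mathbb R^3$ with precisely one double point $x$ is a strong $k$-quasi-embedding if, in addition to $P_0=\{x\}$, there exist PL $3$-balls $P_1,\dots,P_k\subset\mathbb R^3$ and arcs $J_0,\dots,J_k\subset mS^1$ such that $\partial J_0=f^{-1}(x)$, $f^{-1}(P_j)\subset J_j$ for each $j\le k$, $P_j\cup f(J_j)\subset P_{j+1}$ for each $j<k$, and the latter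 inclusion is null-homotopic for each $j<k$. A strong $k$-quasi-isotopy is a generic PL homotopy all of whose singular maps $l_t$ are strong $k$-quasi-embeddings; two PL links are strongly $k$-quasi-isotopic if they are the two ends $l_0,l_1$ of a strong $k$-quasi-isotopy. Theorem. Let $m,k\in\mathbb N$. 1. For each TOP isotopy $h_t\colon mS^1\to\mathbb R^3$ there exists $\varepsilon>0$ such that every generic PL homotopy $l_t$ that is $\varepsilon$-close to $h_t$ (that is, $|l_t(p)-h_t(p)|<\varepsilon$ for all $p\in mS^1$, $t\in I$) is a strong $k$-quasi-isotopy. 2. For each topological link $L\colon mS^1\to\mathbb R^3$ there exists $\varepsilon>0$ such that any two PL links $L_0,L_1\colon mS^1\to\mathbb R^3$ that are $\varepsilon$-close to $L$ are strongly $k$-quasi-isotopic. 3. Any two PL links $L_0,L_1\colon mS^1\to\mathbb R^3$ that are joined by a TOP isotopy are strongly $k$-quasi-isotopic. -/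

import Mathlib

open Set Filter Topology

namespace QuasiIsotopy

/-- Euclidean 3-space. -/
abbrev R3 : Type := EuclideanSpace ℝ (Fin 3)

/-- The disjoint union `mS¹` of `m` circles; each circle is `ℝ / ℤ`, with its usual PL structure. -/
abbrev Circles (m : ℕ) : Type := Fin m × UnitAddCircle

/-! ### Piecewise linear maps, links and homotopies -/

/-- A compact convex polytope: the convex hull of finitely many points. -/
def IsPolytope {E : Type*} [AddCommGroup E] [Module ℝ E] (C : Set E) : Prop :=
  ∃ V : Set E, V.Finite ∧ C = convexHull ℝ V

/-- `f` is piecewise linear on `s`: the set `s` is a finite union of compact convex polytopes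
(so it is a compact polyhedron), on each of which `f` is affine. Such an `f` is automatically
continuous on `s`. -/
def IsPLOn {E F : Type*} [AddCommGroup E] [Module ℝ E] [AddCommGroup F] [Module ℝ F]
    (f : E → F) (s : Set E) : Prop :=
  ∃ 𝒞 : Set (Set E), 𝒞.Finite ∧ s = ⋃₀ 𝒞 ∧
    ∀ C ∈ 𝒞, IsPolytope C ∧ ∃ A : E →ᵃ[ℝ] F, EqOn f A C

/-- A PL map `mS¹ → ℝ³`: on each circle it is PL in the parameter `s ∈ [0,1]`. -/
def IsPLMap {m : ℕ} (f : Circles m → R3) : Prop :=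
  ∀ i : Fin m, IsPLOn (fun s : ℝ => f (i, (s : UnitAddCircle))) (Icc 0 1)

/-- A PL link: a PL embedding of `mS¹` in `ℝ³`. -/
def IsPLLink {m : ℕ} (L : Circles m → R3) : Prop :=
  IsPLMap L ∧ Function.Injective L

/-- A topological link: a topological embedding of the compact space `mS¹` in `ℝ³`. -/
def IsTopLink {m : ℕ} (L : Circles m → R3) : Prop :=
  Continuous L ∧ Function.Injective L

/-- A topological isotopy: a homotopy through one-to-one maps. -/
def IsTopIsotopy {m : ℕ} (h : unitInterval → Circles m → R3) : Prop :=
  Continuous (fun z : unitInterval × Circles m => h z.1 z.2) ∧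
    ∀ t, Function.Injective (h t)

/-- Two links are topologically isotopic if they are the ends of a topological isotopy. -/
def TopIsotopic {m : ℕ} (L L' : Circles m → R3) : Prop :=
  ∃ h : unitInterval → Circles m → R3, IsTopIsotopy h ∧ h 0 = L ∧ h 1 = L'

/-- The real number `t`, clamped to `[0,1]`. -/
noncomputable def clamp (t : ℝ) : unitInterval := projIcc (0 : ℝ) 1 zero_le_one t

/-- A PL homotopy `mS¹ × [0,1] → ℝ³`: on each component it is PL in the parameters
`(t, s) ∈ [0,1]²`, where `t` is the time. -/
def IsPLHomotopy {m : ℕ} (l : unitInterval → Circles m → R3) : Prop :=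
  ∀ i : Fin m, IsPLOn (fun z : ℝ × ℝ => l (clamp z.1) (i, (z.2 : UnitAddCircle)))
    (Icc (0 : ℝ) 1 ×ˢ Icc (0 : ℝ) 1)

/-- `x` is the only double point of `f`, and `p ≠ q` are the two points over it: no point other
than `x` has more than one preimage. -/
def IsOnlyDoublePoint {X Y : Type*} (f : X → Y) (x : Y) (p q : X) : Prop :=
  p ≠ q ∧ f ⁻¹' {x} = {p, q} ∧ ∀ y, y ≠ x → (f ⁻¹' {y}).Subsingleton

/-- The homotopy `l` is affine near the time `t` and the point `p`, in the time and the circle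
coordinate: `v` is the time derivative and `u` is the derivative along the circle. -/
def IsAffineNear {m : ℕ} (l : unitInterval → Circles m → R3) (t : unitInterval) (p : Circles m)
    (v u : R3) : Prop :=
  ∀ᶠ z : ℝ × ℝ in 𝓝 (0, 0),
    l (clamp ((t : ℝ) + z.1)) (p.1, p.2 + (z.2 : UnitAddCircle)) = l t p + z.1 • v + z.2 • u

/-- The two sheets of the track `(t, p) ↦ (t, l t p)` through the points `(t, p)` and `(t, q)` are
flat near these points, and transverse to each other in `ℝ × ℝ³`. The vectors `(1, v)`, `(0, u)`
span the first sheet and `(1, v')`, `(0, u')` span the second one; together they span `ℝ × ℝ³`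
exactly when `u`, `u'`, `v - v'` are linearly independent. -/
def IsTransverseAt {m : ℕ} (l : unitInterval → Circles m → R3) (t : unitInterval)
    (p q : Circles m) : Prop :=
  ∃ v u v' u' : R3, IsAffineNear l t p v u ∧ IsAffineNear l t q v' u' ∧
    LinearIndependent ℝ ![u, u', v - v']

/-- A generic PL homotopy between links: a PL homotopy whose ends are embeddings, which is an
embedding at all but finitely many times, and at each of the exceptional times has precisely one
double point, at which two sheets of the track cross transversely. -/
structure IsGenericPLHomotopy {m : ℕ} (l : unitInterval → Circles m → R3) : Prop where
  pl : IsPLHomotopy l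
  injective_zero : Function.Injective (l 0)
  injective_one : Function.Injective (l 1)
  finite_singular : {t | ¬ Function.Injective (l t)}.Finite
  double_point : ∀ t, ¬ Function.Injective (l t) →
    ∃ x p q, IsOnlyDoublePoint (l t) x p q ∧ IsTransverseAt l t p q

/-! ### Strong `k`-quasi-isotopy -/

/-- A PL 3-ball in `ℝ³`: the image of the cube `[0,1]³` under an injective PL map
(which is then a PL homeomorphism onto its image). -/
def IsPLBall (P : Set R3) : Prop :=
  ∃ φ : R3 → R3, IsPLOn φ {y | ∀ i, y i ∈ Icc (0 : ℝ) 1} ∧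
    InjOn φ {y | ∀ i, y i ∈ Icc (0 : ℝ) 1} ∧ φ '' {y | ∀ i, y i ∈ Icc (0 : ℝ) 1} = P

/-- `J` is an arc with endpoints `a` and `b`. -/
def IsArc {X : Type*} [TopologicalSpace X] (J : Set X) (a b : X) : Prop :=
  ∃ γ : unitInterval → X, Continuous γ ∧ Function.Injective γ ∧ range γ = J ∧ γ 0 = a ∧ γ 1 = b

/-- A strong `k`-quasi-embedding: a PL map `f : mS¹ → ℝ³` with precisely one double point `x`,
such that there are, besides `P 0 = {x}`, PL 3-balls `P 1, …, P k` and arcs `J 0, …, J k` in `mS¹`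
with `∂ (J 0) = f⁻¹ {x}`, with `f⁻¹ (P j) ⊆ J j` for `j ≤ k`, and with `P j ∪ f (J j) ⊆ P (j + 1)`
for `j < k`, the latter inclusion being null-homotopic. (Only the indices up to `k` matter.) -/
def IsStrongQuasiEmbedding {m : ℕ} (k : ℕ) (f : Circles m → R3) : Prop :=
  IsPLMap f ∧ ∃ x p q, IsOnlyDoublePoint f x p q ∧
    ∃ (P : ℕ → Set R3) (J : ℕ → Set (Circles m)),
      P 0 = {x} ∧
      (∀ j, 1 ≤ j → j ≤ k → IsPLBall (P j)) ∧
      IsArc (J 0) p q ∧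
      (∀ j, j ≤ k → ∃ a b, IsArc (J j) a b) ∧
      (∀ j, j ≤ k → f ⁻¹' P j ⊆ J j) ∧
      (∀ j, j < k → ∃ hsub : P j ∪ f '' J j ⊆ P (j + 1),
        (ContinuousMap.inclusion hsub).Nullhomotopic)

/-- A strong `k`-quasi-isotopy: a generic PL homotopy all of whose singular links are strong
`k`-quasi-embeddings. -/
def IsStrongQuasiIsotopy {m : ℕ} (k : ℕ) (l : unitInterval → Circles m → R3) : Prop :=
  IsGenericPLHomotopy l ∧ ∀ t, ¬ Function.Injective (l t) → IsStrongQuasiEmbedding k (l t)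

/-- Two links are strongly `k`-quasi-isotopic if they are joined by a strong `k`-quasi-isotopy. -/
def StronglyQuasiIsotopic {m : ℕ} (k : ℕ) (L L' : Circles m → R3) : Prop :=
  ∃ l : unitInterval → Circles m → R3, IsStrongQuasiIsotopy k l ∧ l 0 = L ∧ l 1 = L'

end QuasiIsotopy

/-! Part 1 is a compactness argument. On `[0,1] × mS¹` the isotopy is uniformly continuous, and by
injectivity points with close images at the same time have close parameters, uniformly in time.
Alternating the two moduli gives `k + 1` nested scales. A map with one double point `x` that is
close to some `h t` then has cubes centered at `x` as its balls `P j` for `j ≥ 1`, with short arcs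
around the double point in the domain as its `J j`. The inclusions are null-homotopic because cubes
are convex (`exists_forall_isStrongQuasiEmbedding`).

Hence near a topological link every generic PL homotopy is a strong quasi-isotopy, and Part 2 only
asks for a small generic homotopy between two nearby PL links. The building block is a push `L + φ •
M` with `φ ≥ 0` PL (`exists_isGenericPLHomotopy`). For almost every `M` only finitely many chords of
`L` are parallel to `M`, and only their ends can collide. Each point starts at its own time and
moves fast, so that no two chord ends move at once; a collision then involves one moving and one
resting point, and it is transverse. The difference of two nearby links is a sum of small terms `φ •
c` with fixed vectors `c`. A fixed `c` may fail to be generic, so one link is pushed along `c + M`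
and the other along `M`: the term disappears from the difference, and both vectors are generic for
almost every `M`.

Part 3 follows from Part 2 by connectedness of `[0,1]`, since PL links approximate every `h t`. -/

open MeasureTheory

namespace QuasiIsotopy

/-! ### Piecewise affine maps on circles and generic directions -/

section

variable {m : ℕ} {V : Type*} [AddCommGroup V] [Module ℝ V]

/-- The parameter interval `[x, y]` has its ends in `S` and its interior misses `S`. -/
structure IsPiece (S : Set ℝ) (x y : ℝ) : Prop where
  left_mem : x ∈ S
  right_mem : y ∈ S
  nonneg : 0 ≤ x
  lt : x < y
  le_one : y ≤ 1
  disjoint : Disjoint (Ioo x y) S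

/-- A finite set of parameters, containing `0` and `1`, at which a PL map may break. -/
structure IsBreakSet (S : Set ℝ) : Prop where
  finite : S.Finite
  zero_mem : (0 : ℝ) ∈ S
  one_mem : (1 : ℝ) ∈ S

/-- `F` is affine in the parameter on every parameter interval whose interior misses `S`. -/
def AffineOff (S : Set ℝ) (F : Circles m → V) : Prop :=
  ∀ (i : Fin m) (x y : ℝ), 0 ≤ x → x < y → y ≤ 1 → Disjoint (Ioo x y) S →
    ∃ P E : V, ∀ s ∈ Icc x y, F (i, (s : UnitAddCircle)) = P + s • E

/-- The slope of `F` on the `i`-th circle between the parameters `x` and `y`. -/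
noncomputable def slopeOn (F : Circles m → V) (i : Fin m) (x y : ℝ) : V :=
  (y - x)⁻¹ • (F (i, (y : UnitAddCircle)) - F (i, (x : UnitAddCircle)))

theorem IsPiece.left_mem_Icc {S : Set ℝ} {x y : ℝ} (h : IsPiece S x y) : x ∈ Icc x y :=
  ⟨le_rfl, h.lt.le⟩

theorem IsPiece.Icc_subset {S : Set ℝ} {x y : ℝ} (h : IsPiece S x y) : Icc x y ⊆ Icc 0 1 :=
  Icc_subset_Icc h.nonneg h.le_one

theorem IsPiece.mem_Ioo {S : Set ℝ} {x y s : ℝ} (h : IsPiece S x y) (hs : s ∈ Icc x y)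
    (hsS : s ∉ S) : s ∈ Ioo x y := by
  refine ⟨lt_of_le_of_ne hs.1 ?_, lt_of_le_of_ne hs.2 ?_⟩
  · rintro rfl; exact hsS h.left_mem
  · rintro rfl; exact hsS h.right_mem

namespace IsBreakSet

variable {S : Set ℝ} (hS : IsBreakSet S)
include hS

theorem exists_piece {s : ℝ} (hs : s ∈ Icc (0 : ℝ) 1) :
    ∃ x y, IsPiece S x y ∧ s ∈ Icc x y := by
  rcases hs.2.lt_or_eq with h1 | h1
  · obtain ⟨x, ⟨hxS, hxs⟩, hx⟩ := (hS.finite.inter_of_left (Iic s)).exists_maximal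
      ⟨0, hS.zero_mem, hs.1⟩
    obtain ⟨y, ⟨hyS, hys⟩, hy⟩ := (hS.finite.inter_of_left (Ioi s)).exists_minimal
      ⟨1, hS.one_mem, h1⟩
    simp only [mem_Iic, mem_Ioi] at hxs hys
    refine ⟨x, y, ⟨hxS, hyS, ?_, lt_of_le_of_lt hxs hys, ?_, ?_⟩, hxs, hys.le⟩
    · by_contra h
      exact h (hx ⟨hS.zero_mem, hs.1⟩ (le_of_not_ge h))
    · by_contra h
      exact h (hy ⟨hS.one_mem, h1⟩ (le_of_not_ge h))
    · rw [Set.disjoint_left]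
      rintro z ⟨hxz, hzy⟩ hz
      rcases le_or_gt z s with h | h
      · exact absurd (hx ⟨hz, h⟩ hxz.le) (not_le.2 hxz)
      · exact absurd (hy ⟨hz, h⟩ hzy.le) (not_le.2 hzy)
  · subst h1
    obtain ⟨x, ⟨hxS, hxs⟩, hx⟩ := (hS.finite.inter_of_left (Iio 1)).exists_maximal
      ⟨0, hS.zero_mem, zero_lt_one (α := ℝ)⟩
    simp only [mem_Iio] at hxs
    refine ⟨x, 1, ⟨hxS, hS.one_mem, ?_, hxs, le_rfl, ?_⟩, hxs.le, le_rfl⟩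
    · by_contra h
      exact h (hx ⟨hS.zero_mem, zero_lt_one (α := ℝ)⟩ (le_of_not_ge h))
    · rw [Set.disjoint_left]
      rintro z ⟨hxz, hzy⟩ hz
      exact absurd (hx ⟨hz, hzy⟩ hxz.le) (not_le.2 hxz)

theorem union {T : Set ℝ} (hT : T.Finite) : IsBreakSet (S ∪ T) :=
  ⟨hS.finite.union hT, Or.inl hS.zero_mem, Or.inl hS.one_mem⟩

end IsBreakSet

theorem exists_param (p : Circles m) : ∃ s ∈ Ico (0 : ℝ) 1, p = (p.1, (s : UnitAddCircle)) := by
  refine ⟨(AddCircle.equivIco 1 0 p.2 : ℝ), ?_, ?_⟩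
  · have := (AddCircle.equivIco (1 : ℝ) 0 p.2).2
    simpa using this
  · ext1
    · rfl
    · exact (AddCircle.coe_equivIco (p := 1) (a := 0)).symm

theorem param_inj {s t : ℝ} (hs : s ∈ Ico (0 : ℝ) 1) (ht : t ∈ Ico (0 : ℝ) 1)
    (h : (s : UnitAddCircle) = t) : s = t := by
  have := (AddCircle.coe_eq_coe_iff_of_mem_Ico (p := (1 : ℝ)) (a := 0) (x := s) (y := t)
    (by simpa using hs) (by simpa using ht)).1 h
  exact this

theorem coe_one_eq_zero : ((1 : ℝ) : UnitAddCircle) = ((0 : ℝ) : UnitAddCircle) := by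
  simp

namespace AffineOff

variable {S T : Set ℝ} {F G : Circles m → V}

theorem mono (hF : AffineOff S F) (h : S ⊆ T) : AffineOff T F :=
  fun i x y hx hxy hy hd => hF i x y hx hxy hy (hd.mono_right h)

theorem const (c : V) : AffineOff S (fun _ : Circles m => c) :=
  fun _ _ _ _ _ _ _ => ⟨c, 0, fun _ _ => by simp⟩

theorem add (hF : AffineOff S F) (hG : AffineOff S G) : AffineOff S (fun p => F p + G p) := by
  intro i x y hx hxy hy hd
  obtain ⟨P, E, h⟩ := hF i x y hx hxy hy hd
  obtain ⟨Q, E', h'⟩ := hG i x y hx hxy hy hd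
  refine ⟨P + Q, E + E', fun s hs => ?_⟩
  simp only [h s hs, h' s hs, smul_add]
  abel

theorem linear {W : Type*} [AddCommGroup W] [Module ℝ W] (hF : AffineOff S F) (f : V →ₗ[ℝ] W) :
    AffineOff S (fun p => f (F p)) := by
  intro i x y hx hxy hy hd
  obtain ⟨P, E, h⟩ := hF i x y hx hxy hy hd
  exact ⟨f P, f E, fun s hs => by simp [h s hs]⟩

theorem smul_const {φ : Circles m → ℝ} (hφ : AffineOff S φ) (c : V) :
    AffineOff S (fun p => φ p • c) :=
  hφ.linear (LinearMap.toSpanSingleton ℝ V c)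

theorem sub (hF : AffineOff S F) (hG : AffineOff S G) : AffineOff S (fun p => F p - G p) := by
  simpa [sub_eq_add_neg] using hF.add (hG.linear (-LinearMap.id))

theorem eq_on_piece (hF : AffineOff S F) {x y : ℝ} (h : IsPiece S x y) (i : Fin m) {s : ℝ}
    (hs : s ∈ Icc x y) :
    F (i, (s : UnitAddCircle)) = F (i, (x : UnitAddCircle)) + (s - x) • slopeOn F i x y := by
  obtain ⟨P, E, h'⟩ := hF i x y h.nonneg h.lt h.le_one h.disjoint
  have hne : y - x ≠ 0 := sub_ne_zero.2 h.lt.ne'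
  have : slopeOn F i x y = E := by
    rw [slopeOn, h' x h.left_mem_Icc, h' y ⟨h.lt.le, le_rfl⟩, add_sub_add_left_eq_sub, ← sub_smul,
      smul_smul, inv_mul_cancel₀ hne, one_smul]
  rw [this, h' s hs, h' x h.left_mem_Icc, sub_smul]
  abel

end AffineOff


/-- Polytopes in `ℝ` are compact intervals. An interval whose interior avoids all their endpoints
lies inside any one of them that contains its midpoint. -/
theorem IsPLOn.exists_breaks {f : ℝ → V} (h : IsPLOn f (Icc 0 1)) :
    ∃ S : Set ℝ, S.Finite ∧ ∀ x y : ℝ, 0 ≤ x → x < y → y ≤ 1 → Disjoint (Ioo x y) S →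
      ∃ P E : V, ∀ s ∈ Icc x y, f s = P + s • E := by
  obtain ⟨𝒞, hfin, hcov, hC⟩ := h
  refine ⟨sInf '' 𝒞 ∪ sSup '' 𝒞, (hfin.image _).union (hfin.image _), ?_⟩
  intro x y hx hxy hy hd
  have hz : (x + y) / 2 ∈ ⋃₀ 𝒞 := hcov ▸ ⟨by linarith, by linarith⟩
  obtain ⟨C, hC𝒞, hzC⟩ := hz
  obtain ⟨⟨W, hW, rfl⟩, A, hA⟩ := hC C hC𝒞
  have hcomp : IsCompact (convexHull ℝ W) := hW.isCompact_convexHull ℝ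
  have hne : (convexHull ℝ W).Nonempty := ⟨_, hzC⟩
  have hlow := csInf_le hcomp.bddBelow hzC
  have hhigh := le_csSup hcomp.bddAbove hzC
  have hInf := hcomp.sInf_mem hne
  have hSup := hcomp.sSup_mem hne
  rw [Set.disjoint_left] at hd
  have h1 : sInf (convexHull ℝ W) ≤ x := by
    by_contra hlt
    exact hd ⟨not_le.1 hlt, by linarith⟩ (Or.inl ⟨_, hC𝒞, rfl⟩)
  have h2 : y ≤ sSup (convexHull ℝ W) := by
    by_contra hlt
    exact hd ⟨by linarith, not_le.1 hlt⟩ (Or.inr ⟨_, hC𝒞, rfl⟩)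
  refine ⟨A 0, A.linear 1, fun s hs => ?_⟩
  have hs' : s ∈ convexHull ℝ W :=
    (convex_convexHull ℝ W).ordConnected.out hInf hSup ⟨h1.trans hs.1, hs.2.trans h2⟩
  rw [hA hs']
  have := A.map_vadd 0 s
  simp only [vadd_eq_add, add_zero] at this
  rw [this, add_comm]
  congr 1
  conv_lhs => rw [← mul_one s, ← smul_eq_mul, map_smul]

theorem IsPLMap.exists_affineOff {F : Circles m → R3} (hF : IsPLMap F) :
    ∃ S, IsBreakSet S ∧ AffineOff S F := by
  choose S hS h using fun i => (hF i).exists_breaks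
  refine ⟨{0, 1} ∪ ⋃ i, S i, ⟨?_, by simp, by simp⟩, ?_⟩
  · exact (toFinite _).union (finite_iUnion hS)
  · intro i x y hx hxy hy hd
    exact h i x y hx hxy hy (hd.mono_right fun z hz => Or.inr (mem_iUnion.2 ⟨i, hz⟩))

/-- Dividing by the nonzero coefficient exhibits the excluded `M` as a two-parameter family. It is
the image of part of the plane `x 2 = 0` under a map of `R3` differentiable there, and such maps
send null sets to null sets. -/
theorem ae_ne_smul_of_affine (P E F : R3) (a b c : ℝ) :
    ∀ᵐ M : R3, ∀ σ τ : ℝ, a + b * σ + c * τ ≠ 0 →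
      P + σ • E + τ • F ≠ (a + b * σ + c * τ) • M := by
  let den : R3 → ℝ := fun x => a + b * x 0 + c * x 1
  let f : R3 → R3 := fun x => (den x)⁻¹ • (P + x 0 • E + x 1 • F)
  let s : Set R3 := {x | x 2 = 0 ∧ den x ≠ 0}
  have hs : volume s = 0 := by
    let K : Submodule ℝ R3 := LinearMap.ker (EuclideanSpace.proj (𝕜 := ℝ) (2 : Fin 3)).toLinearMap
    have hK : volume (K : Set R3) = 0 := by
      apply Measure.addHaar_submodule
      intro htop
      have : (EuclideanSpace.single (2 : Fin 3) (1 : ℝ)) ∈ K := htop ▸ Submodule.mem_top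
      simp [K] at this
    exact measure_mono_null (fun x hx => by simpa [K] using hx.1) hK
  have hf : DifferentiableOn ℝ f s := by
    intro x hx
    apply DifferentiableAt.differentiableWithinAt
    have h0 : ∀ j : Fin 3, DifferentiableAt ℝ (fun y : R3 => y j) x := fun j =>
      (EuclideanSpace.proj (𝕜 := ℝ) j).differentiableAt
    have hden : DifferentiableAt ℝ den x :=
      (((h0 0).const_mul b).const_add a).add ((h0 1).const_mul c)
    exact (hden.inv hx.2).smul ((((h0 0).smul_const E).const_add P).add ((h0 1).smul_const F))
  have h0 := addHaar_image_eq_zero_of_differentiableOn_of_addHaar_eq_zero volume hf hs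
  filter_upwards [measure_eq_zero_iff_ae_notMem.1 h0] with M hM σ τ hne heq
  refine hM ⟨!₂[σ, τ, 0], ⟨by simp, by simpa [den] using hne⟩, ?_⟩
  change (a + b * σ + c * τ)⁻¹ • (P + σ • E + τ • F) = M
  rw [heq, smul_smul, inv_mul_cancel₀ hne, one_smul]

theorem ae_notMem_span {s : Set R3} (hs : Submodule.span ℝ s ≠ ⊤) :
    ∀ᵐ M : R3, M ∉ Submodule.span ℝ s :=
  measure_eq_zero_iff_ae_notMem.1 (Measure.addHaar_submodule volume _ hs)

theorem span_pair_ne_top (u v : R3) : Submodule.span ℝ {u, v} ≠ ⊤ := by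
  intro h
  have h1 := finrank_span_le_card (R := ℝ) ({u, v} : Set R3)
  rw [h, finrank_top, finrank_euclideanSpace_fin] at h1
  have h2 : ({u, v} : Set R3).toFinset.card ≤ 2 := by
    simpa using Finset.card_le_two (a := u) (b := v)
  omega

/-- A property of pairs of points holds for almost every vector if it does so on each pair of
pieces. -/
theorem ae_forall_of_pieces {S : Set ℝ} (hS : IsBreakSet S)
    {Pr : R3 → Fin m → Fin m → ℝ → ℝ → ℝ → ℝ → Prop}
    (h : ∀ i j x y x' y', IsPiece S x y → IsPiece S x' y' → ∀ᵐ M, Pr M i j x y x' y') :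
    ∀ᵐ M, ∀ i j x y x' y', IsPiece S x y → IsPiece S x' y' → Pr M i j x y x' y' := by
  have : ∀ᵐ M, ∀ i j, ∀ x ∈ S, ∀ y ∈ S, ∀ x' ∈ S, ∀ y' ∈ S,
      IsPiece S x y → IsPiece S x' y' → Pr M i j x y x' y' := by
    have hc := hS.finite.countable
    simp only [ae_all_iff, ae_ball_iff hc, eventually_imp_distrib_left]
    intro i j x _ y _ x' _ y' _ hp hp'
    exact h i j x y x' y' hp hp'
  filter_upwards [this] with M hM i j x y x' y' hp hp'
  exact hM i j x hp.left_mem y hp.right_mem x' hp'.left_mem y' hp'.right_mem hp hp'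

/-- This is the general position statement behind both separation and injective approximation. The
functions `ψ` and `χ` are independent so that one of them can be taken to be zero. -/
theorem ae_sub_ne_smul {S : Set ℝ} (hS : IsBreakSet S) {L : Circles m → R3}
    (hL : AffineOff S L) {ψ χ : Circles m → ℝ} (hψ : AffineOff S ψ) (hχ : AffineOff S χ) :
    ∀ᵐ M : R3, ∀ p q, ψ q - χ p ≠ 0 → L p - L q ≠ (ψ q - χ p) • M := by
  have := ae_forall_of_pieces (m := m) hS (Pr := fun M i j x y x' y' =>
    ∀ σ ∈ Icc x y, ∀ τ ∈ Icc x' y',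
      ψ (j, (τ : UnitAddCircle)) - χ (i, (σ : UnitAddCircle)) ≠ 0 →
        L (i, (σ : UnitAddCircle)) - L (j, (τ : UnitAddCircle)) ≠
        (ψ (j, (τ : UnitAddCircle)) - χ (i, (σ : UnitAddCircle))) • M) ?_
  · filter_upwards [this] with M hM p q
    obtain ⟨s, hs, hp⟩ := exists_param p
    obtain ⟨t, ht, hq⟩ := exists_param q
    rw [hp, hq]
    obtain ⟨x, y, hxy, hsx⟩ := hS.exists_piece (Ico_subset_Icc_self hs)
    obtain ⟨x', y', hxy', htx⟩ := hS.exists_piece (Ico_subset_Icc_self ht)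
    exact hM _ _ x y x' y' hxy hxy' s hsx t htx
  · intro i j x y x' y' hp hp'
    filter_upwards [ae_ne_smul_of_affine
      (L (i, (x : UnitAddCircle)) - L (j, (x' : UnitAddCircle))) (slopeOn L i x y)
      (-slopeOn L j x' y') (ψ (j, (x' : UnitAddCircle)) - χ (i, (x : UnitAddCircle)))
      (-slopeOn χ i x y) (slopeOn ψ j x' y')] with M hM σ hσ τ hτ
    have key := hM (σ - x) (τ - x')
    have e : ψ (j, (x' : UnitAddCircle)) - χ (i, (x : UnitAddCircle)) +
        -slopeOn χ i x y * (σ - x) + slopeOn ψ j x' y' * (τ - x') =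
        ψ (j, (τ : UnitAddCircle)) - χ (i, (σ : UnitAddCircle)) := by
      rw [hψ.eq_on_piece hp' j hτ, hχ.eq_on_piece hp i hσ]
      simp only [smul_eq_mul]; ring
    rw [e] at key
    rw [hL.eq_on_piece hp i hσ, hL.eq_on_piece hp' j hτ]
    intro hne heq
    refine key hne ?_
    rw [← heq]
    module

/-- The chords of the link `L` parallel to `M` do not end at the break points, and the edges at
their ends are independent of each other and of `M`. -/
structure IsGoodDirection (S : Set ℝ) (L : Circles m → R3) (M : R3) : Prop where
  vertex : ∀ i j, ∀ σ ∈ S, σ ∈ Icc (0 : ℝ) 1 → ∀ τ ∈ Icc (0 : ℝ) 1, ∀ c : ℝ,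
    L (i, (σ : UnitAddCircle)) - L (j, (τ : UnitAddCircle)) = c • M →
      L (i, (σ : UnitAddCircle)) = L (j, (τ : UnitAddCircle))
  indep : ∀ i j x y x' y', IsPiece S x y → IsPiece S x' y' → ∀ σ ∈ Icc x y, ∀ τ ∈ Icc x' y',
    ∀ c : ℝ, L (i, (σ : UnitAddCircle)) - L (j, (τ : UnitAddCircle)) = c • M →
      L (i, (σ : UnitAddCircle)) ≠ L (j, (τ : UnitAddCircle)) →
      LinearIndependent ℝ ![slopeOn L i x y, slopeOn L j x' y', M]

theorem eq_zero_of_smul_mem_of_notMem {K : Submodule ℝ R3} {M : R3} (hM : M ∉ K) {c : ℝ}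
    (h : c • M ∈ K) : c = 0 := by
  by_contra hc
  exact hM ((K.smul_mem_iff hc).1 h)

theorem linearIndependent_of_notMem_span {E F M : R3} (hEF : LinearIndependent ℝ ![E, F])
    (hM : M ∉ Submodule.span ℝ {E, F}) : LinearIndependent ℝ ![E, F, M] := by
  rw [show ![E, F, M] = Fin.snoc ![E, F] M by
    ext i; fin_cases i <;> rfl]
  rw [linearIndependent_finSnoc]
  refine ⟨hEF, ?_⟩
  simpa [Matrix.range_cons, Matrix.range_empty, Set.pair_comm] using hM

theorem span_insert_ne_top_of_dependent {E F : R3} (hEF : ¬ LinearIndependent ℝ ![E, F]) (R : R3) :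
    Submodule.span ℝ {R, E, F} ≠ ⊤ := by
  intro htop
  apply hEF
  have hr : Set.range ![R, E, F] = {R, E, F} := by
    rw [Matrix.range_cons, Matrix.range_cons, Matrix.range_cons, Matrix.range_empty]
    simp only [union_empty, singleton_union]
  have : LinearIndependent ℝ ![R, E, F] := by
    apply linearIndependent_of_top_le_span_of_card_eq_finrank
    · rw [hr, htop]
    · simp
  have h2 := this.comp (Fin.succ) (Fin.succ_injective 2)
  convert h2 using 1
  ext i; fin_cases i <;> rfl

/-- Chords from a vertex to an edge span at most a plane, which `M` avoids. For two independent
edges, `M` only has to avoid their plane. For two dependent edges all chords between them lie in a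
proper subspace, so an `M` outside it is parallel to no nonzero chord. -/
theorem ae_isGoodDirection {S : Set ℝ} (hS : IsBreakSet S) {L : Circles m → R3}
    (hL : AffineOff S L) : ∀ᵐ M : R3, IsGoodDirection S L M := by
  have hv := ae_forall_of_pieces (m := m) hS (Pr := fun M i j x y x' y' =>
    (∀ τ ∈ Icc x' y', ∀ c : ℝ,
      L (i, (x : UnitAddCircle)) - L (j, (τ : UnitAddCircle)) = c • M →
      L (i, (x : UnitAddCircle)) = L (j, (τ : UnitAddCircle)))) ?_
  have hv' := ae_forall_of_pieces (m := m) hS (Pr := fun M i j x y x' y' =>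
    ∀ σ ∈ Icc x y, ∀ τ ∈ Icc x' y',
    ∀ c : ℝ, L (i, (σ : UnitAddCircle)) - L (j, (τ : UnitAddCircle)) = c • M →
      L (i, (σ : UnitAddCircle)) ≠ L (j, (τ : UnitAddCircle)) →
      LinearIndependent ℝ ![slopeOn L i x y, slopeOn L j x' y', M]) ?_
  · filter_upwards [hv, hv'] with M h1 h2
    refine ⟨?_, h2⟩
    intro i j σ hσ hσ1 τ hτ c heq
    obtain ⟨x', y', hp', hτ'⟩ := hS.exists_piece hτ
    have key : ∀ σ ∈ S, σ ∈ Ico (0 : ℝ) 1 →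
        L (i, (σ : UnitAddCircle)) - L (j, (τ : UnitAddCircle)) = c • M →
        L (i, (σ : UnitAddCircle)) = L (j, (τ : UnitAddCircle)) := by
      intro σ hσ hσ1 heq
      obtain ⟨y, ⟨hyS, hys⟩, hy⟩ := (hS.finite.inter_of_left (Ioi σ)).exists_minimal
        ⟨1, hS.one_mem, hσ1.2⟩
      refine h1 i j σ y x' y' ⟨hσ, hyS, hσ1.1, hys, ?_, ?_⟩ hp' τ hτ' c heq
      · by_contra h
        exact h (hy ⟨hS.one_mem, hσ1.2⟩ (le_of_not_ge h))
      · rw [Set.disjoint_left]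
        rintro z ⟨hxz, hzy⟩ hz
        exact absurd (hy ⟨hz, hxz⟩ hzy.le) (not_le.2 hzy)
    rcases hσ1.2.lt_or_eq with h | h
    · exact key σ hσ ⟨hσ1.1, h⟩ heq
    -- The parameter `1` is the left end of no piece, but it names the same point of the circle as
    -- `0`.
    · subst h
      rw [coe_one_eq_zero] at heq ⊢
      exact key 0 hS.zero_mem ⟨le_rfl, zero_lt_one⟩ heq
  swap
  · intro i j x y x' y' hp hp'
    filter_upwards [ae_notMem_span (span_pair_ne_top
      (L (i, (x : UnitAddCircle)) - L (j, (x' : UnitAddCircle))) (slopeOn L j x' y'))]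
      with M hM τ hτ c heq
    have hc : c = 0 := by
      refine eq_zero_of_smul_mem_of_notMem hM ?_
      rw [← heq, hL.eq_on_piece hp' j hτ, ← sub_sub]
      exact Submodule.sub_mem _ (Submodule.subset_span (by simp))
        (Submodule.smul_mem _ _ (Submodule.subset_span (by simp)))
    rw [hc, zero_smul] at heq
    exact sub_eq_zero.1 heq
  · intro i j x y x' y' hp hp'
    by_cases hEF : LinearIndependent ℝ ![slopeOn L i x y, slopeOn L j x' y']
    · filter_upwards [ae_notMem_span (span_pair_ne_top (slopeOn L i x y) (slopeOn L j x' y'))]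
        with M hM σ _ τ _ c _ _
      exact linearIndependent_of_notMem_span hEF hM
    · filter_upwards [ae_notMem_span (span_insert_ne_top_of_dependent hEF
        (L (i, (x : UnitAddCircle)) - L (j, (x' : UnitAddCircle))))] with M hM σ hσ τ hτ c heq hne
      exfalso
      have hc : c = 0 := by
        refine eq_zero_of_smul_mem_of_notMem hM ?_
        rw [← heq, hL.eq_on_piece hp' j hτ, hL.eq_on_piece hp i hσ, add_sub_add_comm]
        refine Submodule.add_mem _ (Submodule.subset_span (by simp)) (Submodule.sub_mem _ ?_ ?_) <;>
        exact (Submodule.smul_mem _ _ (Submodule.subset_span (by simp)))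
      rw [hc, zero_smul] at heq
      exact hne (sub_eq_zero.1 heq)

end

/-! ### Maps close to a topological isotopy are strong quasi-embeddings -/

section

variable {m : ℕ} {V : Type*} [AddCommGroup V] [Module ℝ V]

theorem isPolytope_of_isCompact_of_convex {C : Set ℝ} (hc : IsCompact C) (hC : Convex ℝ C) :
    IsPolytope C := by
  rcases C.eq_empty_or_nonempty with rfl | hne
  · exact ⟨∅, finite_empty, by simp⟩
  · refine ⟨{sInf C, sSup C}, toFinite _, ?_⟩
    rw [convexHull_pair, segment_eq_Icc (Real.sInf_le_sSup C hc.bddBelow hc.bddAbove)]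
    exact eq_Icc_of_connected_compact ⟨hne, hC.isPreconnected⟩ hc

theorem IsPLHomotopy.isPLMap {l : unitInterval → Circles m → R3} (hl : IsPLHomotopy l)
    (t : unitInterval) : IsPLMap (l t) := by
  intro i
  obtain ⟨𝒞, hfin, hcov, hC⟩ := hl i
  let j : ℝ →ᵃ[ℝ] ℝ × ℝ := AffineMap.lineMap ((t : ℝ), (0 : ℝ)) ((t : ℝ), (1 : ℝ))
  have hj : ∀ s, j s = ((t : ℝ), s) := fun s => by
    simp [j, AffineMap.lineMap_apply]
  refine ⟨(fun C => j ⁻¹' C) '' 𝒞, hfin.image _, ?_, ?_⟩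
  · ext s
    have : ((t : ℝ), s) ∈ Icc (0 : ℝ) 1 ×ˢ Icc (0 : ℝ) 1 ↔ ((t : ℝ), s) ∈ ⋃₀ 𝒞 := by rw [hcov]
    have ht : (t : ℝ) ∈ Icc (0 : ℝ) 1 := t.2
    simp only [mem_prod, ht, true_and, mem_sUnion] at this
    simp only [mem_sUnion, mem_image, exists_exists_and_eq_and, mem_preimage, hj, this]
  · rintro _ ⟨C, hC𝒞, rfl⟩
    obtain ⟨⟨W, hW, rfl⟩, A, hA⟩ := hC C hC𝒞
    refine ⟨isPolytope_of_isCompact_of_convex ?_ ((convex_convexHull ℝ W).affine_preimage j),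
      A.comp j, ?_⟩
    · have hcl : IsClosed (convexHull ℝ W) := (hW.isCompact_convexHull ℝ).isClosed
      have hcont : Continuous j := by
        have : (j : ℝ → ℝ × ℝ) = fun s => ((t : ℝ), s) := funext hj
        rw [this]; fun_prop
      refine (isCompact_Icc (a := (0 : ℝ)) (b := 1)).of_isClosed_subset (hcl.preimage hcont) ?_
      intro s hs
      have : ((t : ℝ), s) ∈ ⋃₀ 𝒞 := ⟨_, hC𝒞, by simpa [hj] using hs⟩
      rw [← hcov] at this
      exact this.2
    · intro s hs
      have := hA (mem_preimage.1 hs)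
      simpa [hj, clamp] using this

/-- The closed cube with center `c` and side `2 * r`. -/
def cube (c : R3) (r : ℝ) : Set R3 := {y | ∀ i, |y i - c i| ≤ r}

theorem isPolytope_unitCube : IsPolytope {y : R3 | ∀ i, y i ∈ Icc (0 : ℝ) 1} := by
  let e : (Fin 3 → ℝ) →ₗ[ℝ] R3 := (WithLp.linearEquiv 2 ℝ (Fin 3 → ℝ)).symm.toLinearMap
  refine ⟨e '' Set.pi univ fun _ => {0, 1}, (Set.Finite.pi fun _ => toFinite _).image _, ?_⟩
  rw [← LinearMap.image_convexHull, convexHull_pi]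
  simp only [convexHull_pair, segment_eq_Icc zero_le_one]
  ext y
  constructor
  · intro hy
    exact ⟨fun i => y i, fun i _ => hy i, rfl⟩
  · rintro ⟨z, hz, rfl⟩ i
    exact hz i trivial

theorem isPLBall_cube (c : R3) {r : ℝ} (hr : 0 < r) : IsPLBall (cube c r) := by
  let A : R3 →ᵃ[ℝ] R3 := (2 * r) • AffineMap.id ℝ R3 +
    AffineMap.const ℝ R3 (c - r • (WithLp.toLp 2 fun _ => 1 : R3))
  have hA : ∀ y i, A y i = 2 * r * y i + (c i - r) := by
    intro y i
    simp [A]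
  refine ⟨A, ⟨{_}, finite_singleton _, (sUnion_singleton _).symm, ?_⟩, ?_, ?_⟩
  · rintro _ rfl
    exact ⟨isPolytope_unitCube, A, fun _ _ => rfl⟩
  · intro y _ z _ h
    ext i
    have := congrArg (fun w : R3 => w i) h
    simp only [hA] at this
    have h2 : 2 * r * (y i - z i) = 0 := by linarith
    rcases mul_eq_zero.1 h2 with h3 | h3 <;> linarith
  · ext y
    constructor
    · rintro ⟨z, hz, rfl⟩ i
      rw [hA, abs_le]
      have := hz i
      constructor <;> nlinarith [this.1, this.2]
    · intro hy
      refine ⟨WithLp.toLp 2 fun i => (y i - c i + r) / (2 * r), fun i => ?_, ?_⟩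
      · have := abs_le.1 (hy i)
        constructor
        · exact div_nonneg (by linarith) (by linarith)
        · exact (div_le_one (by linarith)).2 (by linarith)
      · ext i
        rw [hA]
        field_simp
        ring

theorem convex_cube (c : R3) (r : ℝ) : Convex ℝ (cube c r) := by
  have : cube c r = ⋂ i, (EuclideanSpace.proj (𝕜 := ℝ) i) ⁻¹' (Metric.closedBall (c i) r) := by
    ext y
    simp [cube, Real.dist_eq]
  rw [this]
  exact convex_iInter fun i => (convex_closedBall _ _).linear_preimage
    (EuclideanSpace.proj (𝕜 := ℝ) i).toLinearMap

theorem mem_cube_of_dist_le {c y : R3} {r : ℝ} (h : dist y c ≤ r) : y ∈ cube c r := by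
  intro i
  have := PiLp.norm_apply_le (y - c) i
  rw [← dist_eq_norm, Real.norm_eq_abs] at this
  exact this.trans h

/-- The factor `2` is a crude upper bound for `√3`. -/
theorem dist_le_of_mem_cube {c y : R3} {r : ℝ} (h : y ∈ cube c r) : dist y c ≤ 2 * r := by
  have hr : 0 ≤ r := (abs_nonneg _).trans (h 0)
  rw [EuclideanSpace.dist_eq]
  apply Real.sqrt_le_iff.2
  refine ⟨by positivity, ?_⟩
  have hi : ∀ i, dist (y i) (c i) ^ 2 ≤ r ^ 2 := fun i => by
    rw [Real.dist_eq]
    exact pow_le_pow_left₀ (abs_nonneg _) (h i) 2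
  rw [Fin.sum_univ_three]
  nlinarith [hi 0, hi 1, hi 2]

theorem nullhomotopic_inclusion {A B : Set R3} (hB : Convex ℝ B) (hne : B.Nonempty)
    (h : A ⊆ B) : (ContinuousMap.inclusion h).Nullhomotopic := by
  have := hB.contractibleSpace hne
  exact (id_nullhomotopic B).comp_left (ContinuousMap.inclusion h)

theorem eq_of_coe_eq_of_abs_sub_lt {x y : ℝ} (h : (x : UnitAddCircle) = y) (hxy : |x - y| < 1) :
    x = y := by
  have h0 : ((x - y : ℝ) : UnitAddCircle) = 0 := by
    rw [AddCircle.coe_sub, h, sub_self]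
  obtain ⟨n, hn⟩ := (AddCircle.coe_eq_zero_iff 1).1 h0
  simp only [zsmul_eq_mul, mul_one] at hn
  rw [← hn] at hxy
  have : |n| < 1 := by exact_mod_cast hxy
  rw [Int.abs_lt_one_iff] at this
  rw [this] at hn
  push_cast at hn
  linarith

theorem isArc_image_uIcc (i : Fin m) (c : UnitAddCircle) {a b : ℝ} (hab : a ≠ b)
    (h1 : |b - a| < 1) :
    IsArc ((fun s : ℝ => ((i, c + (s : UnitAddCircle)) : Circles m)) '' uIcc a b)
      (i, c + (a : UnitAddCircle)) (i, c + (b : UnitAddCircle)) := by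
  refine ⟨fun t => (i, c + ((a + t * (b - a) : ℝ) : UnitAddCircle)), ?_, ?_, ?_, ?_, ?_⟩
  · refine continuous_const.prodMk (continuous_const.add ?_)
    exact (AddCircle.continuous_mk' 1).comp (by fun_prop)
  · intro t t' h
    have h2 := add_left_cancel (congrArg Prod.snd h)
    have h3 := eq_of_coe_eq_of_abs_sub_lt h2 ?_
    · have : ((t : ℝ) - t') * (b - a) = 0 := by linarith
      rcases mul_eq_zero.1 this with h4 | h4
      · exact Subtype.ext (sub_eq_zero.1 h4)
      · exact absurd (sub_eq_zero.1 h4).symm hab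
    · have h5 : a + t * (b - a) - (a + t' * (b - a)) = (t - t') * (b - a) := by ring
      rw [h5, abs_mul]
      have h6 : |(t : ℝ) - t'| ≤ 1 := by
        rw [abs_le]
        constructor <;> linarith [t.2.1, t.2.2, t'.2.1, t'.2.2]
      nlinarith [abs_nonneg (b - a), abs_nonneg ((t : ℝ) - t')]
  · rw [← segment_eq_uIcc, segment_eq_image', image_image]
    ext p
    constructor
    · rintro ⟨t, rfl⟩
      exact ⟨t, t.2, by simp⟩
    · rintro ⟨t, ht, rfl⟩
      exact ⟨⟨t, ht⟩, by simp⟩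
  · simp
  · simp

theorem exists_coe_eq_abs_eq_norm (x : UnitAddCircle) : ∃ s : ℝ, (s : UnitAddCircle) = x ∧
    |s| = ‖x‖ := by
  obtain ⟨y, rfl⟩ := QuotientAddGroup.mk_surjective x
  refine ⟨y - round y, ?_, ?_⟩
  · rw [AddCircle.coe_sub]
    have : (((round y : ℤ) : ℝ) : UnitAddCircle) = 0 :=
      (AddCircle.coe_eq_zero_iff 1).2 ⟨round y, by simp⟩
    rw [this, sub_zero]
  · exact (UnitAddCircle.norm_eq (x := y)).symm

namespace IsTopIsotopy

variable {h : unitInterval → Circles m → R3} (hh : IsTopIsotopy h)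
include hh

theorem exists_dist_lt {η : ℝ} (hη : 0 < η) :
    ∃ δ > 0, ∀ (t : unitInterval) (p : Circles m) (s : ℝ), |s| ≤ δ →
      dist (h t (p.1, p.2 + (s : UnitAddCircle))) (h t p) < η := by
  have hcont : Continuous fun z : ℝ × (unitInterval × Circles m) =>
      dist (h z.2.1 (z.2.2.1, z.2.2.2 + (z.1 : UnitAddCircle))) (h z.2.1 z.2.2) := by
    have h1 : Continuous fun z : ℝ × (unitInterval × Circles m) =>
        h z.2.1 (z.2.2.1, z.2.2.2 + (z.1 : UnitAddCircle)) := by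
      refine hh.1.comp (f := fun z : ℝ × (unitInterval × Circles m) =>
        (z.2.1, (z.2.2.1, z.2.2.2 + (z.1 : UnitAddCircle)))) ?_
      have : Continuous fun z : ℝ × (unitInterval × Circles m) => (z.1 : UnitAddCircle) :=
        (AddCircle.continuous_mk' 1).comp continuous_fst
      fun_prop
    exact h1.dist (hh.1.comp continuous_snd)
  have := (isCompact_univ (X := unitInterval × Circles m)).eventually_forall_of_forall_eventually
    (x₀ := (0 : ℝ)) (P := fun s z =>
      dist (h z.1 (z.2.1, z.2.2 + (s : UnitAddCircle))) (h z.1 z.2) < η) ?_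
  · obtain ⟨δ, hδ, H⟩ := Metric.eventually_nhds_iff.1 this
    refine ⟨δ / 2, by positivity, fun t p s hs => H (y := s) ?_ (t, p) trivial⟩
    rw [Real.dist_eq, sub_zero]
    linarith
  · intro z _
    refine hcont.continuousAt.eventually (gt_mem_nhds ?_)
    simpa using hη

/-- The pairs on different circles, or at parameter distance at least `δ`, form together with the
time a compact set. On it the distance of the images is positive by injectivity, so it has a
positive minimum. -/
theorem exists_near {δ : ℝ} (hδ : 0 < δ) :
    ∃ η > 0, ∀ (t : unitInterval) (p q : Circles m), dist (h t q) (h t p) < η →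
      ∃ s : ℝ, |s| ≤ δ ∧ q = (p.1, p.2 + (s : UnitAddCircle)) := by
  let far : Set (unitInterval × Circles m × Circles m) :=
    {z | z.2.1.1 = z.2.2.1 ∧ ‖z.2.2.2 - z.2.1.2‖ < δ}ᶜ
  have hfar : IsCompact far := by
    apply IsClosed.isCompact
    rw [isClosed_compl_iff]
    refine IsOpen.inter (s := {z : unitInterval × Circles m × Circles m | z.2.1.1 = z.2.2.1})
      (t := {z | ‖z.2.2.2 - z.2.1.2‖ < δ}) ?_ (isOpen_lt (by fun_prop) continuous_const)
    exact (isOpen_discrete {x : Fin m × Fin m | x.1 = x.2}).preimage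
      (f := fun z : unitInterval × Circles m × Circles m => (z.2.1.1, z.2.2.1)) (by fun_prop)
  have hcont : Continuous fun z : unitInterval × Circles m × Circles m =>
      dist (h z.1 z.2.2) (h z.1 z.2.1) :=
    (hh.1.comp (f := fun z : unitInterval × Circles m × Circles m => (z.1, z.2.2))
      (by fun_prop)).dist (hh.1.comp
      (f := fun z : unitInterval × Circles m × Circles m => (z.1, z.2.1)) (by fun_prop))
  have hmin : ∃ η > 0, ∀ z ∈ far, η ≤ dist (h z.1 z.2.2) (h z.1 z.2.1) := by
    rcases far.eq_empty_or_nonempty with he | hne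
    · exact ⟨1, one_pos, by simp [he]⟩
    · obtain ⟨z, hz, hmin⟩ := hfar.exists_isMinOn hne hcont.continuousOn
      refine ⟨_, ?_, fun w hw => hmin hw⟩
      rw [gt_iff_lt, dist_pos]
      intro heq
      have := hh.2 z.1 heq
      exact hz ⟨by rw [this], by simpa [this] using hδ⟩
  obtain ⟨η, hη, H⟩ := hmin
  refine ⟨η, hη, fun t p q hd => ?_⟩
  by_contra hcon
  refine absurd (H (t, p, q) ?_) (not_le.2 hd)
  rintro ⟨h1, h2⟩
  obtain ⟨s, hs, hs'⟩ := exists_coe_eq_abs_eq_norm (q.2 - p.2)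
  exact hcon ⟨s, hs' ▸ h2.le, Prod.ext h1.symm (by simp [hs])⟩

end IsTopIsotopy

/-- Two sequences of sizes such that passing from one to the next one respects the bounds `A`
and `B`. -/
theorem exists_radii {A B : ℝ → ℝ} (hA : ∀ η, 0 < η → 0 < A η) (hB : ∀ δ, 0 < δ → 0 < B δ) :
    ∃ r δ : ℕ → ℝ, (∀ n, 0 < r n) ∧ (∀ n, 0 < δ n) ∧ (∀ n, δ n ≤ 1 / 4) ∧ Antitone r ∧
      (∀ n, 4 * r n ≤ B (δ n)) ∧ ∀ n, δ (n + 1) ≤ A (r n / 2) := by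
  -- The cap `1 / 4` makes an arc with parameters in `[-δ, δ]` shorter than the circle, hence
  -- embedded.
  let d : ℝ → ℝ := fun x => min (1 / 4) (A (x / 2))
  let r : ℕ → ℝ := fun n => Nat.rec (B (1 / 4) / 4) (fun _ x => min x (B (d x) / 4)) n
  have hd : ∀ x, 0 < x → 0 < d x := fun x hx => lt_min (by norm_num) (hA _ (by linarith))
  have hr : ∀ n, 0 < r n := by
    intro n
    induction n with
    | zero => exact div_pos (hB _ (by norm_num)) (by norm_num)
    | succ n ih => exact lt_min ih (div_pos (hB _ (hd _ ih)) (by norm_num))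
  refine ⟨r, fun n => Nat.casesOn n (1 / 4) fun k => d (r k), hr, ?_, ?_, ?_, ?_, ?_⟩
  · rintro (_ | n)
    · norm_num
    · exact hd _ (hr n)
  · rintro (_ | n)
    · exact le_rfl
    · exact min_le_left _ _
  · exact antitone_nat_of_succ_le fun n => min_le_left _ _
  · rintro (_ | n)
    · exact (mul_div_cancel₀ _ (by norm_num)).le
    · have : r (n + 1) ≤ B (d (r n)) / 4 := min_le_right _ _
      change 4 * r (n + 1) ≤ B (d (r n))
      linarith
  · intro n
    exact min_le_right _ _

/-- The scales shrink with `n`, while the balls grow with `j`; hence the index `k - j`. Points of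
`f` in the cube of size `r n` have parameters within `δ n` of `p`, and the arc of size `δ (n + 1)`
is mapped into the cube of size `r n`. -/
theorem IsTopIsotopy.exists_forall_isStrongQuasiEmbedding {h : unitInterval → Circles m → R3}
    (hh : IsTopIsotopy h) (k : ℕ) :
    ∃ ε > 0, ∀ (t : unitInterval) (f : Circles m → R3), IsPLMap f →
      (∃ x p q, IsOnlyDoublePoint f x p q) → (∀ p, dist (f p) (h t p) < ε) →
      IsStrongQuasiEmbedding k f := by
  -- Positivity is a premise under the existential, so that the moduli become total functions of a
  -- real number.
  have hA : ∀ η : ℝ, ∃ δ : ℝ, 0 < η → 0 < δ ∧ ∀ (t : unitInterval) (p : Circles m) (s : ℝ),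
      |s| ≤ δ → dist (h t (p.1, p.2 + (s : UnitAddCircle))) (h t p) < η := by
    intro η
    by_cases hη : 0 < η
    · obtain ⟨δ, h1, h2⟩ := hh.exists_dist_lt hη
      exact ⟨δ, fun _ => ⟨h1, h2⟩⟩
    · exact ⟨0, fun h => absurd h hη⟩
  have hB : ∀ δ : ℝ, ∃ η : ℝ, 0 < δ → 0 < η ∧ ∀ (t : unitInterval) (p q : Circles m),
      dist (h t q) (h t p) < η → ∃ s : ℝ, |s| ≤ δ ∧ q = (p.1, p.2 + (s : UnitAddCircle)) := by
    intro δ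
    by_cases hδ : 0 < δ
    · obtain ⟨η, h1, h2⟩ := hh.exists_near hδ
      exact ⟨η, fun _ => ⟨h1, h2⟩⟩
    · exact ⟨0, fun h => absurd h hδ⟩
  choose A hA using hA
  choose B hB using hB
  obtain ⟨r, δ, hr, hδ, hδ4, hanti, hrB, hδA⟩ :=
    exists_radii (fun η hη => (hA η hη).1) (fun δ hδ => (hB δ hδ).1)
  -- Replacing `f` by `h t` at two points changes their distance by less than `r k / 2`, and `r k`
  -- is the smallest radius in use.
  refine ⟨r k / 4, by linarith [hr k], fun t f hf ⟨x, p, q, hdp⟩ hclose => ⟨hf, x, p, q, hdp, ?_⟩⟩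
  obtain ⟨hpq, hpre, -⟩ := id hdp
  have hfp : f p = x := by
    have : p ∈ f ⁻¹' {x} := hpre ▸ Or.inl rfl
    exact this
  have hfq : f q = x := by
    have : q ∈ f ⁻¹' {x} := hpre ▸ Or.inr rfl
    exact this
  have hfh : ∀ a b, dist (f a) (f b) < dist (h t a) (h t b) + r k / 2 := by
    intro a b
    have h1 := dist_triangle4 (f a) (h t a) (h t b) (f b)
    have h2 := hclose a
    have h3 := hclose b
    rw [dist_comm] at h3
    linarith
  have hhf : ∀ a b, dist (h t a) (h t b) < dist (f a) (f b) + r k / 2 := by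
    intro a b
    have h1 := dist_triangle4 (h t a) (f a) (f b) (h t b)
    have h2 := hclose a
    have h3 := hclose b
    rw [dist_comm] at h2
    linarith
  have hnear : ∀ n ≤ k, ∀ a, dist (f a) x ≤ 2 * r n →
      ∃ s : ℝ, |s| ≤ δ n ∧ a = (p.1, p.2 + (s : UnitAddCircle)) := by
    intro n hn a ha
    refine (hB (δ n) (hδ n)).2 t p a ?_
    have h1 := hhf a p
    rw [hfp] at h1
    have := hanti hn
    linarith [hrB n, hr n]
  obtain ⟨s₀, hs₀, hq⟩ := hnear k le_rfl q (by rw [hfq, dist_self]; linarith [hr k])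
  have hs₀ne : (0 : ℝ) ≠ s₀ := by
    rintro rfl
    exact hpq (by rw [hq]; simp)
  let c : ℝ → Circles m := fun s => (p.1, p.2 + (s : UnitAddCircle))
  -- The arc `J 0` must end exactly at `p` and `q`; the other arcs are centered at `p`.
  let J : ℕ → Set (Circles m) := fun j =>
    if j = 0 then c '' uIcc 0 s₀ else c '' uIcc (-δ (k - j)) (δ (k - j))
  have hJ : ∀ j, ∀ a ∈ J j, ∃ s : ℝ, |s| ≤ δ (k - j) ∧ a = c s := by
    intro j a ha
    by_cases hj : j = 0
    · subst hj
      simp only [J, if_true] at ha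
      obtain ⟨s, hs, rfl⟩ := ha
      refine ⟨s, ?_, rfl⟩
      rw [Nat.sub_zero]
      refine le_trans ?_ hs₀
      simpa using abs_sub_left_of_mem_uIcc hs
    · simp only [J, if_neg hj] at ha
      obtain ⟨s, hs, rfl⟩ := ha
      rw [uIcc_of_le (by linarith [hδ (k - j)])] at hs
      exact ⟨s, abs_le.2 hs, rfl⟩
  obtain ⟨P, hP0, hP⟩ : ∃ P : ℕ → Set R3, P 0 = {x} ∧ ∀ j ≠ 0, P j = cube x (r (k - j)) :=
    ⟨fun j => if j = 0 then {x} else cube x (r (k - j)), by simp, fun j hj => by simp [hj]⟩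
  refine ⟨P, J, hP0, ?_, ?_, ?_, ?_, ?_⟩
  · intro j hj _
    rw [hP j (by omega)]
    exact isPLBall_cube x (hr _)
  · have := isArc_image_uIcc p.1 p.2 hs₀ne (by rw [sub_zero]; linarith [hδ4 k])
    simp only [J, if_true]
    rw [hq]
    simpa using this
  · intro j hj
    by_cases hj0 : j = 0
    · subst hj0
      simp only [J, if_true]
      exact ⟨_, _, isArc_image_uIcc p.1 p.2 hs₀ne (by rw [sub_zero]; linarith [hδ4 k])⟩
    · simp only [J, if_neg hj0]
      refine ⟨_, _, isArc_image_uIcc p.1 p.2 (by linarith [hδ (k - j)]) ?_⟩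
      rw [abs_lt]
      constructor <;> linarith [hδ (k - j), hδ4 (k - j)]
  · intro j hj
    by_cases hj0 : j = 0
    · subst hj0
      rw [hP0, hpre]
      simp only [J, if_true]
      rintro a (rfl | rfl)
      · exact ⟨0, left_mem_uIcc, by simp [c]⟩
      · exact ⟨s₀, right_mem_uIcc, hq.symm⟩
    · rw [hP j hj0]
      simp only [J, if_neg hj0]
      intro a ha
      obtain ⟨s, hs, rfl⟩ := hnear (k - j) (Nat.sub_le _ _) a (dist_le_of_mem_cube ha)
      refine ⟨s, ?_, rfl⟩
      rw [uIcc_of_le (by linarith [hδ (k - j)])]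
      exact abs_le.1 hs
  · intro j hj
    obtain ⟨n, hn⟩ : ∃ n, k - j = n + 1 := ⟨k - j - 1, by omega⟩
    have hPn : P (j + 1) = cube x (r n) := by
      rw [hP _ (Nat.succ_ne_zero j), show k - (j + 1) = n by omega]
    have hx : x ∈ cube x (r n) := mem_cube_of_dist_le (by rw [dist_self]; exact (hr n).le)
    have hsub : P j ∪ f '' J j ⊆ P (j + 1) := by
      rw [hPn]
      apply union_subset
      · by_cases hj0 : j = 0
        · rw [hj0, hP0]
          exact singleton_subset_iff.2 hx
        · rw [hP j hj0]
          exact fun y hy i => (hy i).trans (hanti (by omega))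
      · rintro _ ⟨a, ha, rfl⟩
        obtain ⟨s, hs, rfl⟩ := hJ j a ha
        apply mem_cube_of_dist_le
        have h1 := hfh (c s) p
        have h2 := (hA (r n / 2) (by linarith [hr n])).2 t p s (hs.trans (by rw [hn]; exact hδA n))
        have h3 : r k ≤ r n := hanti (by omega)
        rw [hfp] at h1
        change dist (h t (c s)) (h t p) < r n / 2 at h2
        linarith
    exact ⟨hsub, nullhomotopic_inclusion (hPn ▸ convex_cube _ _) ⟨x, hPn ▸ hx⟩ hsub⟩

theorem IsTopIsotopy.exists_forall_isStrongQuasiIsotopy {h : unitInterval → Circles m → R3}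
    (hh : IsTopIsotopy h) (k : ℕ) :
    ∃ ε > 0, ∀ l : unitInterval → Circles m → R3, IsGenericPLHomotopy l →
      (∀ t p, dist (l t p) (h t p) < ε) → IsStrongQuasiIsotopy k l := by
  obtain ⟨ε, hε, H⟩ := hh.exists_forall_isStrongQuasiEmbedding k
  refine ⟨ε, hε, fun l hl hclose => ⟨hl, fun t ht => ?_⟩⟩
  obtain ⟨x, p, q, hdp, -⟩ := hl.double_point t ht
  exact H t (l t) (hl.pl.isPLMap t) ⟨x, p, q, hdp⟩ (hclose t)

end

/-! ### Reversing and concatenating generic PL homotopies -/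

section

variable {m : ℕ}

section PL

variable {E F : Type*} [AddCommGroup E] [Module ℝ E] [AddCommGroup F] [Module ℝ F]

theorem IsPLOn.union {f : E → F} {s t : Set E} (hs : IsPLOn f s) (ht : IsPLOn f t) :
    IsPLOn f (s ∪ t) := by
  obtain ⟨𝒞, h1, h2, h3⟩ := hs
  obtain ⟨𝒟, h1', h2', h3'⟩ := ht
  refine ⟨𝒞 ∪ 𝒟, h1.union h1', by rw [sUnion_union, ← h2, ← h2'], ?_⟩
  rintro C (hC | hC)
  exacts [h3 C hC, h3' C hC]

theorem IsPLOn.congr {f g : E → F} {s : Set E} (hf : IsPLOn f s) (h : EqOn g f s) :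
    IsPLOn g s := by
  obtain ⟨𝒞, h1, h2, h3⟩ := hf
  refine ⟨𝒞, h1, h2, fun C hC => ⟨(h3 C hC).1, ?_⟩⟩
  obtain ⟨A, hA⟩ := (h3 C hC).2
  exact ⟨A, fun x hx => (h (h2 ▸ ⟨C, hC, hx⟩)).trans (hA hx)⟩

/-- The inverse `B` carries the vertices of a polytope to those of its preimage under `A`. -/
theorem IsPLOn.comp_affineMap {f : E → F} {s : Set E} (hf : IsPLOn f s) (A B : E →ᵃ[ℝ] E)
    (hAB : ∀ x, A (B x) = x) (hBA : ∀ x, B (A x) = x) : IsPLOn (f ∘ A) (A ⁻¹' s) := by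
  obtain ⟨𝒞, h1, h2, h3⟩ := hf
  refine ⟨(fun C => A ⁻¹' C) '' 𝒞, h1.image _, ?_, ?_⟩
  · rw [h2, sUnion_image, preimage_sUnion]
  · rintro _ ⟨C, hC, rfl⟩
    obtain ⟨⟨W, hW, rfl⟩, A', hA'⟩ := h3 C hC
    refine ⟨⟨B '' W, hW.image _, ?_⟩, A'.comp A, fun x hx => hA' hx⟩
    rw [← AffineMap.image_convexHull]
    exact (congrFun (Set.image_eq_preimage_of_inverse hAB hBA) _).symm

end PL

/-- The affine map `(t, s) ↦ (a * t + b, s)`. -/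
noncomputable def timeMap (a b : ℝ) : ℝ × ℝ →ᵃ[ℝ] ℝ × ℝ :=
  (LinearMap.prodMap (a • LinearMap.id) LinearMap.id : ℝ × ℝ →ₗ[ℝ] ℝ × ℝ).toAffineMap +
    AffineMap.const ℝ (ℝ × ℝ) (b, (0 : ℝ))

theorem timeMap_apply (a b : ℝ) (z : ℝ × ℝ) : timeMap a b z = (a * z.1 + b, z.2) := by
  simp [timeMap]

theorem IsPLOn.comp_timeMap {f : ℝ × ℝ → R3} {s : Set (ℝ × ℝ)} (hf : IsPLOn f s) {a : ℝ}
    (ha : a ≠ 0) (b : ℝ) : IsPLOn (f ∘ timeMap a b) (timeMap a b ⁻¹' s) := by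
  refine hf.comp_affineMap _ (timeMap a⁻¹ (-(a⁻¹ * b))) ?_ ?_ <;> intro z <;>
  · simp only [timeMap_apply]
    ext1 <;> simp only
    field_simp
    ring

theorem coe_clamp {t : ℝ} (ht : t ∈ Icc (0 : ℝ) 1) : (clamp t : ℝ) = t := by
  rw [clamp, projIcc_of_mem _ ht]

theorem clamp_coe (t : unitInterval) : clamp t = t := projIcc_val _ t

theorem clamp_zero : clamp 0 = 0 := clamp_coe 0

theorem clamp_one : clamp 1 = 1 := clamp_coe 1

theorem linearIndependent_smul_last {u u' w : R3} (h : LinearIndependent ℝ ![u, u', w]) {a : ℝ}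
    (ha : a ≠ 0) : LinearIndependent ℝ ![u, u', a • w] := by
  have := h.units_smul ![1, 1, Units.mk0 a ha]
  convert this using 1
  ext i j
  fin_cases i <;> simp

theorem IsAffineNear.comp_time {l l' : unitInterval → Circles m → R3} {t t' : unitInterval}
    {p : Circles m} {v u : R3} {a : ℝ}
    (hl : ∀ᶠ x : ℝ in 𝓝 0, l' (clamp (t' + x)) = l (clamp (t + a * x)))
    (h : IsAffineNear l t p v u) : IsAffineNear l' t' p (a • v) u := by
  have h0 : l' t' = l t := by
    have := hl.self_of_nhds
    simpa [clamp_coe] using this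
  have hc : Tendsto (fun z : ℝ × ℝ => (a * z.1, z.2)) (𝓝 (0, 0)) (𝓝 (0, 0)) := by
    have : Continuous fun z : ℝ × ℝ => (a * z.1, z.2) := by fun_prop
    simpa using this.tendsto (0, 0)
  have hfst : Tendsto (fun z : ℝ × ℝ => z.1) (𝓝 (0, 0)) (𝓝 0) :=
    continuous_fst.tendsto ((0 : ℝ), (0 : ℝ))
  filter_upwards [hc.eventually h, hfst.eventually hl] with z h1 h2
  rw [h2, h1, h0, smul_smul, mul_comm]

/-- A change of speed multiplies the relative velocity `v - v'` by `a ≠ 0` and fixes the tangents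
along the circles. Reversal uses `a = -1`, concatenation `a = 2`. -/
theorem IsTransverseAt.comp_time {l l' : unitInterval → Circles m → R3} {t t' : unitInterval}
    {p q : Circles m} {a : ℝ} (ha : a ≠ 0)
    (hl : ∀ᶠ x : ℝ in 𝓝 0, l' (clamp (t' + x)) = l (clamp (t + a * x)))
    (h : IsTransverseAt l t p q) : IsTransverseAt l' t' p q := by
  obtain ⟨v, u, v', u', h1, h2, h3⟩ := h
  refine ⟨_, _, _, _, h1.comp_time hl, h2.comp_time hl, ?_⟩
  rw [← smul_sub]
  exact linearIndependent_smul_last h3 ha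

theorem IsGenericPLHomotopy.symm {l : unitInterval → Circles m → R3}
    (hl : IsGenericPLHomotopy l) : IsGenericPLHomotopy fun t => l (unitInterval.symm t) where
  pl := by
    intro i
    have h := (hl.pl i).comp_timeMap (a := -1) (by norm_num) 1
    have hs : timeMap (-1) 1 ⁻¹' (Icc (0 : ℝ) 1 ×ˢ Icc (0 : ℝ) 1) = Icc (0 : ℝ) 1 ×ˢ Icc (0 : ℝ) 1 := by
      ext z
      simp only [mem_preimage, timeMap_apply, mem_prod, mem_Icc]
      constructor <;> rintro ⟨⟨h1, h2⟩, h3⟩ <;> exact ⟨⟨by linarith, by linarith⟩, h3⟩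
    rw [hs] at h
    refine h.congr fun z hz => ?_
    simp only [Function.comp, timeMap_apply]
    congr 2
    ext
    rw [unitInterval.coe_symm_eq, coe_clamp hz.1, coe_clamp]
    · ring
    · constructor <;> linarith [hz.1.1, hz.1.2]
  injective_zero := by simpa using hl.injective_one
  injective_one := by simpa using hl.injective_zero
  finite_singular := hl.finite_singular.preimage (unitInterval.symm_bijective.injective.injOn)
  double_point := by
    intro t ht
    obtain ⟨x, p, q, h1, h2⟩ := hl.double_point _ ht
    refine ⟨x, p, q, h1, h2.comp_time (a := -1) (by norm_num) ?_⟩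
    -- Clamping commutes with the reflection of `[0,1]` for all real times, including those outside
    -- the interval.
    refine Eventually.of_forall fun x => ?_
    congr 1
    ext
    simp only [unitInterval.coe_symm_eq, clamp, coe_projIcc]
    rcases le_total (0 : ℝ) (t + x) with h | h <;> rcases le_total ((t : ℝ) + x) 1 with h' | h' <;>
    simp only [max_def, min_def] <;> split_ifs <;> linarith

theorem StronglyQuasiIsotopic.symm {k : ℕ} {L L' : Circles m → R3}
    (h : StronglyQuasiIsotopic k L L') : StronglyQuasiIsotopic k L' L := by
  obtain ⟨l, ⟨h1, h2⟩, h3, h4⟩ := h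
  exact ⟨_, ⟨h1.symm, fun t ht => h2 _ ht⟩, by simpa using h4, by simpa using h3⟩

open Classical in
/-- The homotopy `l` followed by `l'`. -/
noncomputable def concat (l l' : unitInterval → Circles m → R3) : unitInterval → Circles m → R3 :=
  fun t => if (t : ℝ) ≤ 1 / 2 then l (clamp (2 * t)) else l' (clamp (2 * t - 1))

section Concat

variable {l l' : unitInterval → Circles m → R3}

theorem concat_clamp_left {x : ℝ} (h0 : 0 ≤ x) (h1 : x ≤ 1 / 2) :
    concat l l' (clamp x) = l (clamp (2 * x)) := by
  rw [concat, coe_clamp ⟨h0, by linarith⟩, if_pos h1]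

theorem concat_clamp_right (h : l 1 = l' 0) {x : ℝ} (h0 : 1 / 2 ≤ x) (h1 : x ≤ 1) :
    concat l l' (clamp x) = l' (clamp (2 * x - 1)) := by
  rw [concat, coe_clamp ⟨by linarith, h1⟩]
  split_ifs with h2
  · have : x = 1 / 2 := le_antisymm h2 h0
    subst this
    norm_num [clamp_zero, clamp_one, h]
  · rfl

theorem concat_zero : concat l l' 0 = l 0 := by
  have := concat_clamp_left (l := l) (l' := l') le_rfl (by norm_num : (0 : ℝ) ≤ 1 / 2)
  rwa [mul_zero, clamp_zero] at this

theorem concat_one (h : l 1 = l' 0) : concat l l' 1 = l' 1 := by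
  have := concat_clamp_right h (by norm_num : (1 : ℝ) / 2 ≤ 1) le_rfl
  rwa [show (2 : ℝ) * 1 - 1 = 1 by norm_num, clamp_one] at this

/-- Near a singular time the concatenation is one of the two homotopies, at double speed. -/
theorem concat_eventually_eq (h : l 1 = l' 0) (h0 : Function.Injective (l 0))
    (h1 : Function.Injective (l 1)) (h1' : Function.Injective (l' 1)) {t : unitInterval}
    (ht : ¬ Function.Injective (concat l l' t)) :
    (∃ τ : unitInterval, t = clamp (τ / 2) ∧ concat l l' t = l τ ∧
      ∀ᶠ x : ℝ in 𝓝 0, concat l l' (clamp (t + x)) = l (clamp (τ + 2 * x))) ∨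
    ∃ τ : unitInterval, t = clamp ((τ + 1) / 2) ∧ concat l l' t = l' τ ∧
      ∀ᶠ x : ℝ in 𝓝 0, concat l l' (clamp (t + x)) = l' (clamp (τ + 2 * x)) := by
  have hc : Tendsto (fun x : ℝ => (t : ℝ) + x) (𝓝 0) (𝓝 t) := by
    have : Continuous fun x : ℝ => (t : ℝ) + x := by fun_prop
    simpa using this.tendsto 0
  have ht0 : 0 < (t : ℝ) := by
    refine t.2.1.lt_of_ne fun h' => ht ?_
    rw [show t = 0 from Subtype.ext h'.symm, concat_zero]
    exact h0
  have ht1 : (t : ℝ) < 1 := by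
    refine t.2.2.lt_of_ne fun h' => ht ?_
    rw [show t = 1 from Subtype.ext h', concat_one h]
    exact h1'
  rcases lt_trichotomy (t : ℝ) (1 / 2) with hlt | heq | hgt
  · left
    have hτ := coe_clamp (t := 2 * (t : ℝ)) ⟨by linarith, by linarith⟩
    refine ⟨clamp (2 * t), ?_, ?_, ?_⟩
    · rw [hτ, mul_div_cancel_left₀ _ two_ne_zero, clamp_coe]
    · rw [← concat_clamp_left (l := l) (l' := l') ht0.le hlt.le, clamp_coe]
    · filter_upwards [hc.eventually (Ioo_mem_nhds ht0 hlt)] with x hx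
      rw [hτ, concat_clamp_left hx.1.le hx.2.le, mul_add]
  -- The junction is not a singular time because `l 1` is an embedding, so nothing has to be affine
  -- across the seam.
  · exfalso
    apply ht
    rw [← clamp_coe t, heq, concat_clamp_left (by norm_num) le_rfl,
      show (2 : ℝ) * (1 / 2) = 1 by norm_num, clamp_one]
    exact h1
  · right
    have hτ := coe_clamp (t := 2 * (t : ℝ) - 1) ⟨by linarith, by linarith⟩
    refine ⟨clamp (2 * t - 1), ?_, ?_, ?_⟩
    · rw [hτ, sub_add_cancel, mul_div_cancel_left₀ _ two_ne_zero, clamp_coe]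
    · rw [← concat_clamp_right h hgt.le ht1.le, clamp_coe]
    · filter_upwards [hc.eventually (Ioo_mem_nhds hgt ht1)] with x hx
      rw [hτ, concat_clamp_right h hx.1.le hx.2.le]
      congr 2
      ring

theorem IsGenericPLHomotopy.concat (hl : IsGenericPLHomotopy l) (hl' : IsGenericPLHomotopy l')
    (h : l 1 = l' 0) : IsGenericPLHomotopy (concat l l') where
  pl := by
    intro i
    have h1 := (hl.pl i).comp_timeMap (a := 2) (by norm_num) 0
    have h2 := (hl'.pl i).comp_timeMap (a := 2) (by norm_num) (-1)
    have hs : Icc (0 : ℝ) 1 ×ˢ Icc (0 : ℝ) 1 =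
        timeMap 2 0 ⁻¹' (Icc (0 : ℝ) 1 ×ˢ Icc (0 : ℝ) 1) ∪
        timeMap 2 (-1) ⁻¹' (Icc (0 : ℝ) 1 ×ˢ Icc (0 : ℝ) 1) := by
      ext z
      simp only [mem_union, mem_preimage, timeMap_apply, mem_prod, mem_Icc]
      constructor
      · rintro ⟨⟨h1, h2⟩, h3⟩
        rcases le_total z.1 (1 / 2) with h | h
        · exact Or.inl ⟨⟨by linarith, by linarith⟩, h3⟩
        · exact Or.inr ⟨⟨by linarith, by linarith⟩, h3⟩
      · rintro (⟨⟨h1, h2⟩, h3⟩ | ⟨⟨h1, h2⟩, h3⟩) <;> exact ⟨⟨by linarith, by linarith⟩, h3⟩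
    rw [hs]
    refine (h1.congr fun z hz => ?_).union (h2.congr fun z hz => ?_)
    · simp only [mem_preimage, timeMap_apply, mem_prod, mem_Icc] at hz
      simp only [Function.comp, timeMap_apply]
      rw [concat_clamp_left (by linarith) (by linarith), add_zero]
    · simp only [mem_preimage, timeMap_apply, mem_prod, mem_Icc] at hz
      simp only [Function.comp, timeMap_apply]
      rw [concat_clamp_right h (by linarith) (by linarith), sub_eq_add_neg]
  injective_zero := by rw [concat_zero]; exact hl.injective_zero
  injective_one := by rw [concat_one h]; exact hl'.injective_one
  finite_singular := by
    refine ((hl.finite_singular.image fun τ : unitInterval => clamp (τ / 2)).union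
      (hl'.finite_singular.image fun τ : unitInterval => clamp ((τ + 1) / 2))).subset ?_
    intro t ht
    rcases concat_eventually_eq h hl.injective_zero hl.injective_one hl'.injective_one ht with
      ⟨τ, h1, h2, -⟩ | ⟨τ, h1, h2, -⟩
    · exact Or.inl ⟨τ, fun hinj => ht (h2 ▸ hinj), h1.symm⟩
    · exact Or.inr ⟨τ, fun hinj => ht (h2 ▸ hinj), h1.symm⟩
  double_point := by
    intro t ht
    rcases concat_eventually_eq h hl.injective_zero hl.injective_one hl'.injective_one ht with
      ⟨τ, -, h2, h3⟩ | ⟨τ, -, h2, h3⟩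
    · obtain ⟨x, p, q, h4, h5⟩ := hl.double_point τ (by rwa [← h2])
      exact ⟨x, p, q, by rwa [h2], h5.comp_time two_ne_zero h3⟩
    · obtain ⟨x, p, q, h4, h5⟩ := hl'.double_point τ (by rwa [← h2])
      exact ⟨x, p, q, by rwa [h2], h5.comp_time two_ne_zero h3⟩

end Concat

theorem StronglyQuasiIsotopic.trans {k : ℕ} {L L' L'' : Circles m → R3}
    (h : StronglyQuasiIsotopic k L L') (h' : StronglyQuasiIsotopic k L' L'') :
    StronglyQuasiIsotopic k L L'' := by
  obtain ⟨l, ⟨h1, h2⟩, h3, h4⟩ := h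
  obtain ⟨l', ⟨h1', h2'⟩, h3', h4'⟩ := h'
  have h : l 1 = l' 0 := h4.trans h3'.symm
  refine ⟨concat l l', ⟨h1.concat h1' h, fun t ht => ?_⟩, concat_zero.trans h3,
    (concat_one h).trans h4'⟩
  rcases concat_eventually_eq h h1.injective_zero h1.injective_one h1'.injective_one ht with
    ⟨τ, -, e, -⟩ | ⟨τ, -, e, -⟩
  · rw [e] at ht ⊢
    exact h2 τ ht
  · rw [e] at ht ⊢
    exact h2' τ ht

end

/-! ### The push: piecewise linearity and local affine form -/

section

variable {m : ℕ}

section PL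

variable {E F : Type*} [AddCommGroup E] [Module ℝ E] [AddCommGroup F] [Module ℝ F]

theorem IsPLOn.biUnion {ι : Type*} {I : Set ι} (hI : I.Finite) {f : E → F} {s : ι → Set E}
    (h : ∀ i ∈ I, IsPLOn f (s i)) : IsPLOn f (⋃ i ∈ I, s i) := by
  induction I, hI using Set.Finite.induction_on with
  | empty => exact ⟨∅, finite_empty, by simp, by simp⟩
  | insert _ _ ih =>
    rw [biUnion_insert]
    exact (h _ (mem_insert _ _)).union (ih fun i hi => h i (mem_insert_of_mem _ hi))

end PL

/-- The part of the strip `x ≤ s ≤ y` of the plane of the points `(t, s)` between the lines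
`t = a + b * s` and `t = c + d * s`. -/
def trapezoid (x y a b c d : ℝ) : Set (ℝ × ℝ) :=
  {z | z.2 ∈ Icc x y ∧ a + b * z.2 ≤ z.1 ∧ z.1 ≤ c + d * z.2}

theorem isPolytope_trapezoid {x y a b c d : ℝ} (hxy : x < y) (hx : a + b * x ≤ c + d * x)
    (hy : a + b * y ≤ c + d * y) : IsPolytope (trapezoid x y a b c d) := by
  let W : Set (ℝ × ℝ) := {(a + b * x, x), (c + d * x, x), (a + b * y, y), (c + d * y, y)}
  refine ⟨W, toFinite _, Subset.antisymm ?_ (convexHull_min ?_ ?_)⟩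
  · rintro ⟨t, s⟩ ⟨⟨h1, h2⟩, h3, h4⟩
    simp only at h1 h2 h3 h4
    have hpos : 0 < y - x := sub_pos.2 hxy
    have hconv := convex_convexHull ℝ W
    have hside : ∀ e f : ℝ, (e + f * x, x) ∈ W → (e + f * y, y) ∈ W →
        (e + f * s, s) ∈ convexHull ℝ W := by
      intro e f hl hr
      have := hconv (subset_convexHull ℝ W hl) (subset_convexHull ℝ W hr)
        (a := (y - s) / (y - x)) (b := (s - x) / (y - x))
        (div_nonneg (by linarith) hpos.le) (div_nonneg (by linarith) hpos.le)
        (by field_simp; ring)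
      convert this using 1
      ext <;> simp <;> field_simp <;> ring
    have hA := hside a b (by simp [W]) (by simp [W])
    have hB := hside c d (by simp [W]) (by simp [W])
    -- The two lines may meet on the side of the strip; the cross-section is then a point, and the
    -- convex weights would divide by zero.
    rcases (h3.trans h4).lt_or_eq with hlt | heq
    · have hpos' : 0 < (c + d * s) - (a + b * s) := sub_pos.2 hlt
      have := hconv hA hB (a := ((c + d * s) - t) / ((c + d * s) - (a + b * s)))
        (b := (t - (a + b * s)) / ((c + d * s) - (a + b * s)))
        (div_nonneg (by linarith) hpos'.le) (div_nonneg (by linarith) hpos'.le)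
        (by rw [← add_div, div_eq_one_iff_eq hpos'.ne']; ring)
      convert this using 1
      ext <;> simp only [Prod.smul_mk, Prod.mk_add_mk, smul_eq_mul] <;>
      · rw [div_mul_eq_mul_div, div_mul_eq_mul_div, ← add_div, eq_div_iff hpos'.ne']
        ring
    · rwa [show t = a + b * s by linarith]
  · rintro _ (rfl | rfl | rfl | rfl)
    · exact ⟨⟨le_rfl, hxy.le⟩, le_rfl, hx⟩
    · exact ⟨⟨le_rfl, hxy.le⟩, hx, le_rfl⟩
    · exact ⟨⟨hxy.le, le_rfl⟩, le_rfl, hy⟩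
    · exact ⟨⟨hxy.le, le_rfl⟩, hy, le_rfl⟩
  · rintro ⟨t, s⟩ ⟨⟨h1, h2⟩, h3, h4⟩ ⟨t', s'⟩ ⟨⟨h1', h2'⟩, h3', h4'⟩ μ ν hμ hν hμν
    obtain rfl : ν = 1 - μ := by linarith
    simp only at h1 h2 h3 h4 h1' h2' h3' h4'
    simp only [Prod.smul_mk, Prod.mk_add_mk, smul_eq_mul]
    refine ⟨⟨?_, ?_⟩, ?_, ?_⟩ <;> simp only
    · linarith [mul_le_mul_of_nonneg_left h1 hμ, mul_le_mul_of_nonneg_left h1' hν]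
    · linarith [mul_le_mul_of_nonneg_left h2 hμ, mul_le_mul_of_nonneg_left h2' hν]
    · linarith [mul_le_mul_of_nonneg_left h3 hμ, mul_le_mul_of_nonneg_left h3' hν]
    · linarith [mul_le_mul_of_nonneg_left h4 hμ, mul_le_mul_of_nonneg_left h4' hν]

theorem isPLOn_trapezoid {x y a b c d : ℝ} (hxy : x < y) (hx : a + b * x ≤ c + d * x)
    (hy : a + b * y ≤ c + d * y) {f : ℝ × ℝ → R3} (P u v : R3)
    (hf : ∀ z ∈ trapezoid x y a b c d, f z = P + z.1 • u + z.2 • v) :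
    IsPLOn f (trapezoid x y a b c d) := by
  refine ⟨{_}, finite_singleton _, (sUnion_singleton _).symm, ?_⟩
  rintro _ rfl
  refine ⟨isPolytope_trapezoid hxy hx hy,
    (LinearMap.coprod (LinearMap.toSpanSingleton ℝ R3 u)
      (LinearMap.toSpanSingleton ℝ R3 v)).toAffineMap + AffineMap.const ℝ (ℝ × ℝ) P, ?_⟩
  intro z hz
  rw [hf z hz]
  simp
  abel

/-- The amount by which the point `p` has been pushed at the time `t`: it starts moving at the
time `θ p`, has speed `N`, and stops when it has gone the distance `φ p`. -/
noncomputable def pushAmount (φ θ : Circles m → ℝ) (N t : ℝ) (p : Circles m) : ℝ :=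
  max 0 (min (N * (t - θ p)) (φ p))

/-- The homotopy which pushes the link `L` in the direction of `M`. -/
noncomputable def push (L : Circles m → R3) (φ θ : Circles m → ℝ) (N : ℝ) (M : R3)
    (t : unitInterval) (p : Circles m) : R3 :=
  L p + pushAmount φ θ N t p • M

section Push

variable {L : Circles m → R3} {φ θ : Circles m → ℝ} {N : ℝ} {M : R3}

theorem pushAmount_of_le {t : ℝ} {p : Circles m} (h : N * (t - θ p) ≤ 0) :
    pushAmount φ θ N t p = 0 :=
  max_eq_left ((min_le_left _ _).trans h)

theorem pushAmount_of_ge {t : ℝ} {p : Circles m} (hφ : 0 ≤ φ p) (h : φ p ≤ N * (t - θ p)) :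
    pushAmount φ θ N t p = φ p := by
  rw [pushAmount, min_eq_right h, max_eq_right hφ]

theorem pushAmount_of_mem {t : ℝ} {p : Circles m} (h0 : 0 ≤ N * (t - θ p))
    (h : N * (t - θ p) ≤ φ p) : pushAmount φ θ N t p = N * (t - θ p) := by
  rw [pushAmount, min_eq_left h, max_eq_right h0]

/-- Over one piece the lines `t = θ` and `t = θ + φ / N` cut the strip into the regimes before,
during and after the motion, and the push is affine on each. The bound `hend` places the second line
inside the time interval. -/
theorem isPLHomotopy_push {S : Set ℝ} (hS : IsBreakSet S) (hL : AffineOff S L)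
    (hφ : AffineOff S φ) (hθ : AffineOff S θ) (hφ0 : ∀ p, 0 ≤ φ p) (hθ0 : ∀ p, 0 ≤ θ p)
    (hN : 0 < N) (hend : ∀ p, θ p + φ p / N ≤ 1) : IsPLHomotopy (push L φ θ N M) := by
  intro i
  let I : Set (ℝ × ℝ) := {w ∈ S ×ˢ S | IsPiece S w.1 w.2}
  have hI : I.Finite := (hS.finite.prod hS.finite).subset (sep_subset _ _)
  have hcov : Icc (0 : ℝ) 1 ×ˢ Icc (0 : ℝ) 1 = ⋃ w ∈ I, Icc (0 : ℝ) 1 ×ˢ Icc w.1 w.2 := by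
    ext z
    simp only [mem_iUnion, mem_prod, exists_prop]
    constructor
    · rintro ⟨h1, h2⟩
      obtain ⟨x, y, hp, hz⟩ := hS.exists_piece h2
      exact ⟨(x, y), ⟨⟨hp.left_mem, hp.right_mem⟩, hp⟩, h1, hz⟩
    · rintro ⟨w, hw, h1, h2⟩
      exact ⟨h1, hw.2.Icc_subset h2⟩
  rw [hcov]
  refine IsPLOn.biUnion hI ?_
  rintro ⟨x, y⟩ ⟨-, hp⟩
  simp only at hp ⊢
  obtain ⟨P, E, hPE⟩ := hL i x y hp.nonneg hp.lt hp.le_one hp.disjoint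
  obtain ⟨a, b, hab⟩ := hφ i x y hp.nonneg hp.lt hp.le_one hp.disjoint
  obtain ⟨c, d, hcd⟩ := hθ i x y hp.nonneg hp.lt hp.le_one hp.disjoint
  simp only [smul_eq_mul, mul_comm _ b, mul_comm _ d] at hab hcd
  have hθs : ∀ s ∈ Icc x y, 0 ≤ c + d * s := fun s hs => hcd s hs ▸ hθ0 _
  have hφs : ∀ s ∈ Icc x y, 0 ≤ a + b * s := fun s hs => hab s hs ▸ hφ0 _
  have hends : ∀ s ∈ Icc x y, c + d * s + (a + b * s) / N ≤ 1 := fun s hs => by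
    rw [← hab s hs, ← hcd s hs]; exact hend _
  have hdivs : ∀ s ∈ Icc x y, 0 ≤ (a + b * s) / N := fun s hs => div_nonneg (hφs s hs) hN.le
  have hsplit : ∀ s, (c + a / N) + (d + b / N) * s = c + d * s + (a + b * s) / N := fun s => by
    field_simp; ring
  have hx : x ∈ Icc x y := ⟨le_rfl, hp.lt.le⟩
  have hy : y ∈ Icc x y := ⟨hp.lt.le, le_rfl⟩
  have hstrip : Icc (0 : ℝ) 1 ×ˢ Icc x y = trapezoid x y 0 0 c d ∪
      (trapezoid x y c d (c + a / N) (d + b / N) ∪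
        trapezoid x y (c + a / N) (d + b / N) 1 0) := by
    ext ⟨t, s⟩
    simp only [trapezoid, mem_prod, mem_union, mem_ofPred, zero_mul, add_zero, hsplit]
    constructor
    · rintro ⟨h1, h2⟩
      rcases le_total t (c + d * s) with h | h
      · exact Or.inl ⟨h2, h1.1, h⟩
      · rcases le_total t (c + d * s + (a + b * s) / N) with h' | h'
        · exact Or.inr (Or.inl ⟨h2, h, h'⟩)
        · exact Or.inr (Or.inr ⟨h2, h', h1.2⟩)
    · rintro (⟨h1, h2, h3⟩ | ⟨h1, h2, h3⟩ | ⟨h1, h2, h3⟩)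
      · exact ⟨⟨h2, by linarith [hends s h1, hdivs s h1]⟩, h1⟩
      · exact ⟨⟨by linarith [hθs s h1], by linarith [hends s h1]⟩, h1⟩
      · exact ⟨⟨by linarith [hθs s h1, hdivs s h1], h3⟩, h1⟩
  have hin : ∀ z ∈ Icc (0 : ℝ) 1 ×ˢ Icc x y,
      push L φ θ N M (clamp z.1) (i, (z.2 : UnitAddCircle)) =
        P + z.2 • E + pushAmount φ θ N z.1 (i, (z.2 : UnitAddCircle)) • M := fun z hz => by
    rw [push, coe_clamp hz.1, hPE _ hz.2]
  have hle : ∀ t s : ℝ, t ≤ c + d * s + (a + b * s) / N ↔ N * (t - (c + d * s)) ≤ a + b * s :=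
    fun t s => by
      rw [← sub_le_iff_le_add', le_div_iff₀ hN, mul_comm _ N]
  have hge : ∀ t s : ℝ, c + d * s + (a + b * s) / N ≤ t ↔ a + b * s ≤ N * (t - (c + d * s)) :=
    fun t s => by
      rw [← le_sub_iff_add_le', div_le_iff₀ hN, mul_comm _ N]
  rw [hstrip]
  refine (isPLOn_trapezoid hp.lt ?_ ?_ P 0 E ?_).union
    ((isPLOn_trapezoid hp.lt ?_ ?_ (P - (N * c) • M) (N • M) (E - (N * d) • M) ?_).union
    (isPLOn_trapezoid hp.lt ?_ ?_ (P + a • M) 0 (E + b • M) ?_))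
  · simpa using hθs x hx
  · simpa using hθs y hy
  · intro z hz
    rw [hin z (hstrip ▸ Or.inl hz), pushAmount_of_le]
    · simp
    · rw [hcd _ hz.1]
      exact mul_nonpos_of_nonneg_of_nonpos hN.le (by linarith [hz.2.2])
  · rw [hsplit]; linarith [hdivs x hx]
  · rw [hsplit]; linarith [hdivs y hy]
  · intro z hz
    rw [hin z (hstrip ▸ Or.inr (Or.inl hz)), pushAmount_of_mem, hcd _ hz.1]
    · module
    · rw [hcd _ hz.1]
      exact mul_nonneg hN.le (by linarith [hz.2.1])
    · rw [hcd _ hz.1, hab _ hz.1, ← hle, ← hsplit]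
      exact hz.2.2
  · rw [hsplit]; linarith [hends x hx]
  · rw [hsplit]; linarith [hends y hy]
  · intro z hz
    rw [hin z (hstrip ▸ Or.inr (Or.inr hz)), pushAmount_of_ge (hφ0 _), hab _ hz.1]
    · module
    · rw [hcd _ hz.1, hab _ hz.1, ← hge, ← hsplit]
      exact hz.2.1

/-- `F` is affine with slope `u` near the point `p`. -/
def HasSlope {V : Type*} [AddCommGroup V] [Module ℝ V] (F : Circles m → V) (p : Circles m)
    (u : V) : Prop :=
  ∀ᶠ z : ℝ in 𝓝 0, F (p.1, p.2 + (z : UnitAddCircle)) = F p + z • u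

theorem AffineOff.hasSlope {V : Type*} [AddCommGroup V] [Module ℝ V] {F : Circles m → V}
    {S : Set ℝ} (hF : AffineOff S F) {x y s : ℝ} (h : IsPiece S x y) (hs : s ∈ Ioo x y)
    (i : Fin m) : HasSlope F (i, (s : UnitAddCircle)) (slopeOn F i x y) := by
  have hc : Tendsto (fun z : ℝ => s + z) (𝓝 0) (𝓝 s) := by
    have : Continuous fun z : ℝ => s + z := by fun_prop
    simpa using this.tendsto 0
  filter_upwards [hc.eventually (Icc_mem_nhds hs.1 hs.2)] with z hz
  have h1 := hF.eq_on_piece h i hz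
  have h2 := hF.eq_on_piece h i (Ioo_subset_Icc_self hs)
  simp only [AddCircle.coe_add] at h1
  simp only [h1, h2]
  module

theorem isAffineNear_push {t : unitInterval} (ht : (t : ℝ) ∈ Ioo 0 1) {p : Circles m} {u : R3}
    (hL : HasSlope L p u) {g a b : ℝ}
    (hg : ∀ᶠ z : ℝ × ℝ in 𝓝 (0, 0),
      pushAmount φ θ N (t + z.1) (p.1, p.2 + (z.2 : UnitAddCircle)) = g + z.1 * a + z.2 * b) :
    IsAffineNear (push L φ θ N M) t p (a • M) (u + b • M) := by
  have hfst : Tendsto (fun z : ℝ × ℝ => (t : ℝ) + z.1) (𝓝 (0, 0)) (𝓝 t) := by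
    have : Continuous fun z : ℝ × ℝ => (t : ℝ) + z.1 := by fun_prop
    simpa using this.tendsto (0, 0)
  have hsnd : Tendsto (fun z : ℝ × ℝ => z.2) (𝓝 (0, 0)) (𝓝 0) :=
    continuous_snd.tendsto ((0 : ℝ), (0 : ℝ))
  have hg0 : pushAmount φ θ N t p = g := by
    have := hg.self_of_nhds
    simpa using this
  filter_upwards [hfst.eventually (Icc_mem_nhds ht.1 ht.2), hsnd.eventually hL, hg] with z h1 h2 h3
  rw [push, push, coe_clamp h1, h3, h2, hg0]
  module

section Near

variable {t : unitInterval} {p : Circles m} {u : R3} {b d : ℝ}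

theorem tendsto_push_slack (hθ : HasSlope θ p d) :
    Tendsto (fun z : ℝ × ℝ => N * ((t : ℝ) + z.1 - θ (p.1, p.2 + (z.2 : UnitAddCircle))))
      (𝓝 (0, 0)) (𝓝 (N * (t - θ p))) := by
  have hsnd : Tendsto (fun z : ℝ × ℝ => z.2) (𝓝 (0, 0)) (𝓝 0) :=
    continuous_snd.tendsto ((0 : ℝ), (0 : ℝ))
  have hc : Continuous fun z : ℝ × ℝ => N * ((t : ℝ) + z.1 - (θ p + z.2 • d)) := by fun_prop
  have := hc.tendsto (0, 0)
  simp only [add_zero, zero_smul] at this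
  refine this.congr' ?_
  filter_upwards [hsnd.eventually hθ] with z hz
  rw [hz]

theorem tendsto_of_hasSlope (hφ : HasSlope φ p b) :
    Tendsto (fun z : ℝ × ℝ => φ (p.1, p.2 + (z.2 : UnitAddCircle))) (𝓝 (0, 0)) (𝓝 (φ p)) := by
  have hsnd : Tendsto (fun z : ℝ × ℝ => z.2) (𝓝 (0, 0)) (𝓝 0) :=
    continuous_snd.tendsto ((0 : ℝ), (0 : ℝ))
  have hc : Continuous fun z : ℝ × ℝ => φ p + z.2 • b := by fun_prop
  have := hc.tendsto (0, 0)
  simp only [add_zero, zero_smul] at this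
  refine this.congr' ?_
  filter_upwards [hsnd.eventually hφ] with z hz
  rw [hz]

theorem isAffineNear_push_before (ht : (t : ℝ) ∈ Ioo 0 1) (hL : HasSlope L p u)
    (hθ : HasSlope θ p d) (h : N * (t - θ p) < 0) :
    IsAffineNear (push L φ θ N M) t p ((0 : ℝ) • M) (u + (0 : ℝ) • M) := by
  refine isAffineNear_push (g := 0) ht hL ?_
  filter_upwards [(tendsto_push_slack hθ).eventually (gt_mem_nhds h)] with z hz
  rw [pushAmount_of_le hz.le]
  ring

theorem isAffineNear_push_after (hφ0 : ∀ p, 0 ≤ φ p) (ht : (t : ℝ) ∈ Ioo 0 1)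
    (hL : HasSlope L p u) (hθ : HasSlope θ p d) (hφ : HasSlope φ p b) (h : φ p < N * (t - θ p)) :
    IsAffineNear (push L φ θ N M) t p ((0 : ℝ) • M) (u + b • M) := by
  refine isAffineNear_push (g := φ p) ht hL ?_
  have hsnd : Tendsto (fun z : ℝ × ℝ => z.2) (𝓝 (0, 0)) (𝓝 0) :=
    continuous_snd.tendsto ((0 : ℝ), (0 : ℝ))
  filter_upwards [(tendsto_of_hasSlope hφ).eventually_lt (tendsto_push_slack hθ) h,
    hsnd.eventually hφ] with z hz hz'
  rw [pushAmount_of_ge (hφ0 _) hz.le, hz', smul_eq_mul]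
  ring

theorem isAffineNear_push_during (ht : (t : ℝ) ∈ Ioo 0 1) (hL : HasSlope L p u)
    (hθ : HasSlope θ p d) (hφ : HasSlope φ p b) (h0 : 0 < N * (t - θ p))
    (h : N * (t - θ p) < φ p) :
    IsAffineNear (push L φ θ N M) t p (N • M) (u + (-(N * d)) • M) := by
  refine isAffineNear_push (g := N * (t - θ p)) ht hL ?_
  have hsnd : Tendsto (fun z : ℝ × ℝ => z.2) (𝓝 (0, 0)) (𝓝 0) :=
    continuous_snd.tendsto ((0 : ℝ), (0 : ℝ))
  filter_upwards [(tendsto_push_slack hθ).eventually_lt (tendsto_of_hasSlope hφ) h,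
    (tendsto_push_slack hθ).eventually (lt_mem_nhds h0), hsnd.eventually hθ] with z hz hz0 hz'
  rw [pushAmount_of_mem hz0.le hz.le, hz', smul_eq_mul]
  ring

end Near

end Push

end

/-! ### Genericity of the push -/

section

variable {m : ℕ}

/-- The parameter in `[0, 1)` of a point of `mS¹`. -/
noncomputable def param (p : Circles m) : ℝ := AddCircle.equivIco 1 0 p.2

theorem param_mem (p : Circles m) : param p ∈ Ico (0 : ℝ) 1 := by
  simpa [param] using (AddCircle.equivIco (1 : ℝ) 0 p.2).2

theorem coe_param (p : Circles m) : (p.1, (param p : UnitAddCircle)) = p :=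
  Prod.ext rfl AddCircle.coe_equivIco

theorem param_coe (i : Fin m) {s : ℝ} (hs : s ∈ Ico (0 : ℝ) 1) :
    param (i, (s : UnitAddCircle)) = s :=
  param_inj (param_mem _) hs (congrArg Prod.snd (coe_param (i, (s : UnitAddCircle))))

/-- The PL function on `mS¹` which increases from `0` with slope `1`, and then decreases to `0`
with slope `-K`. -/
noncomputable def tent (K : ℝ) (p : Circles m) : ℝ := min (param p) (K * (1 - param p))

theorem tent_coe {K : ℝ} (hK : 0 ≤ K) (i : Fin m) {s : ℝ} (hs : s ∈ Icc (0 : ℝ) 1) :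
    tent K (i, (s : UnitAddCircle)) = min s (K * (1 - s)) := by
  rcases hs.2.lt_or_eq with h | h
  · rw [tent, param_coe i ⟨hs.1, h⟩]
  · subst h
    rw [coe_one_eq_zero, tent, param_coe i ⟨le_rfl, zero_lt_one⟩]
    simpa using hK

theorem tent_nonneg {K : ℝ} (hK : 0 ≤ K) (p : Circles m) : 0 ≤ tent K p :=
  le_min (param_mem p).1 (mul_nonneg hK (by linarith [(param_mem p).2]))

theorem tent_le_one (K : ℝ) (p : Circles m) : tent K p ≤ 1 :=
  (min_le_left _ _).trans (param_mem p).2.le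

theorem le_slope_mul_iff {K : ℝ} (hK : 0 < K) {s : ℝ} : s ≤ K * (1 - s) ↔ s ≤ K / (K + 1) := by
  rw [le_div_iff₀ (by linarith)]
  constructor <;> intro h <;> linarith

theorem affineOff_tent {K : ℝ} (hK : 0 < K) : AffineOff {K / (K + 1)} (tent K : Circles m → ℝ) := by
  intro i x y hx hxy hy hd
  have hsub : ∀ s ∈ Icc x y, s ∈ Icc (0 : ℝ) 1 := fun s hs => ⟨hx.trans hs.1, hs.2.trans hy⟩
  rw [disjoint_singleton_right] at hd
  rcases le_or_gt y (K / (K + 1)) with h | h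
  · refine ⟨0, 1, fun s hs => ?_⟩
    rw [tent_coe hK.le i (hsub s hs), min_eq_left ((le_slope_mul_iff hK).2 (hs.2.trans h))]
    simp
  · have h' : K / (K + 1) ≤ x := by
      by_contra hlt
      exact hd ⟨not_le.1 hlt, h⟩
    refine ⟨K, -K, fun s hs => ?_⟩
    rw [tent_coe hK.le i (hsub s hs), min_eq_right]
    · simp only [smul_eq_mul]; ring
    · rcases (h'.trans hs.1).eq_or_lt with he | hlt
      · rw [← he]
        field_simp
        simp
      · exact le_of_not_ge fun hle => absurd ((le_slope_mul_iff hK).1 hle) (not_le.2 hlt)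

theorem affineOff_fst {S : Set ℝ} : AffineOff S (fun p : Circles m => ((p.1 : ℕ) : ℝ)) :=
  fun i _ _ _ _ _ _ => ⟨((i : ℕ) : ℝ), 0, fun _ _ => by simp⟩

/-- A sufficient separation of `L` from its translate along `φ • M`. -/
def IsSeparated (L : Circles m → R3) (φ : Circles m → ℝ) (M : R3) : Prop :=
  ∀ p q, p ≠ q → ∀ x ∈ ({0, φ p} : Set ℝ), ∀ y ∈ ({0, φ q} : Set ℝ), L p + x • M ≠ L q + y • M

/-- A coincidence makes the chord equal to `(y - x) • M`, with `y ≠ x` by injectivity of `L`. The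
possible coefficients `φ q - φ p`, `φ q` and `-φ p` are all covered by `ae_sub_ne_smul`, the last
one after exchanging the points. -/
theorem ae_isSeparated {S : Set ℝ} (hS : IsBreakSet S) {L : Circles m → R3} (hL : AffineOff S L)
    (hinj : Function.Injective L) {φ : Circles m → ℝ} (hφ : AffineOff S φ) :
    ∀ᵐ M : R3, IsSeparated L φ M := by
  filter_upwards [ae_sub_ne_smul hS hL hφ hφ, ae_sub_ne_smul hS hL hφ (AffineOff.const 0)]
    with M h1 h2 p q hpq x hx y hy heq
  have hne : L p ≠ L q := fun h => hpq (hinj h)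
  have key : L p - L q = (y - x) • M := by
    rw [sub_smul, sub_eq_sub_iff_add_eq_add, heq, add_comm]
  have hyx : y - x ≠ 0 := fun h => hne (sub_eq_zero.1 (by rw [key, h, zero_smul]))
  rcases hx with rfl | rfl <;> rcases hy with rfl | rfl
  · exact hyx (sub_zero 0)
  · exact h2 p q hyx key
  · refine h2 q p (by simpa using hyx) ?_
    rw [← neg_sub (L p), key, ← neg_smul, neg_sub]
  · exact h1 p q hyx key

/-- The ends of the chords of `L` parallel to `M`. -/
def chordEnds (L : Circles m → R3) (M : R3) : Set (Circles m) :=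
  {p | ∃ q, p ≠ q ∧ ∃ c : ℝ, L p - L q = c • M}

theorem mem_chordEnds_right {L : Circles m → R3} {M : R3} {p q : Circles m} (hpq : p ≠ q) {c : ℝ}
    (h : L p - L q = c • M) : q ∈ chordEnds L M :=
  ⟨p, hpq.symm, -c, by rw [← neg_sub, h, neg_smul]⟩

theorem smul_eq_zero_of_linearIndependent {E F M : R3} (h : LinearIndependent ℝ ![E, F, M])
    {a b c : ℝ} (h0 : a • E + b • F + c • M = 0) : a = 0 ∧ b = 0 ∧ c = 0 := by
  have := Fintype.linearIndependent_iff.1 h ![a, b, c] (by simpa [Fin.sum_univ_three] using h0)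
  exact ⟨this 0, this 1, this 2⟩

/-- Two chords parallel to `M` between the same two pieces differ by a linear relation among the two
slopes and `M`. Independence makes it trivial, so each of the finitely many ordered pairs of pieces
contributes at most one end. -/
theorem finite_chordEnds {S : Set ℝ} (hS : IsBreakSet S) {L : Circles m → R3}
    (hL : AffineOff S L) (hinj : Function.Injective L) {M : R3} (hM : IsGoodDirection S L M) :
    (chordEnds L M).Finite := by
  let R : Fin m → Fin m → ℝ → ℝ → ℝ → ℝ → Set (Circles m) := fun i j x y x' y' =>
    {p | IsPiece S x y ∧ IsPiece S x' y' ∧ ∃ σ ∈ Icc x y, ∃ τ ∈ Icc x' y', ∃ c : ℝ,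
      p = (i, (σ : UnitAddCircle)) ∧ p ≠ (j, (τ : UnitAddCircle)) ∧
      L (i, (σ : UnitAddCircle)) - L (j, (τ : UnitAddCircle)) = c • M}
  have hR : ∀ i j x y x' y', (R i j x y x' y').Subsingleton := by
    rintro i j x y x' y' p ⟨hp, hp', σ, hσ, τ, hτ, c, rfl, hne, hc⟩
      q ⟨-, -, σ₂, hσ₂, τ₂, hτ₂, c₂, rfl, -, hc₂⟩
    have hli := hM.indep i j x y x' y' hp hp' σ hσ τ hτ c hc fun h => hne (hinj h)
    rw [hL.eq_on_piece hp i hσ, hL.eq_on_piece hp' j hτ] at hc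
    rw [hL.eq_on_piece hp i hσ₂, hL.eq_on_piece hp' j hτ₂] at hc₂
    have h0 : (σ - σ₂) • slopeOn L i x y + (τ₂ - τ) • slopeOn L j x' y' + (c₂ - c) • M = 0 := by
      rw [sub_smul c₂, ← hc, ← hc₂]
      module
    have := (smul_eq_zero_of_linearIndependent hli h0).1
    rw [sub_eq_zero.1 this]
  have hfin : (⋃ i, ⋃ j, ⋃ x ∈ S, ⋃ y ∈ S, ⋃ x' ∈ S, ⋃ y' ∈ S, R i j x y x' y').Finite := by
    refine finite_iUnion fun i => finite_iUnion fun j => ?_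
    refine hS.finite.biUnion fun x _ => hS.finite.biUnion fun y _ => ?_
    exact hS.finite.biUnion fun x' _ => hS.finite.biUnion fun y' _ => (hR i j x y x' y').finite
  refine hfin.subset ?_
  rintro p ⟨q, hpq, c, hc⟩
  obtain ⟨s, hs, hps⟩ := exists_param p
  obtain ⟨t, ht, hqt⟩ := exists_param q
  obtain ⟨x, y, hp, hsx⟩ := hS.exists_piece (Ico_subset_Icc_self hs)
  obtain ⟨x', y', hp', htx⟩ := hS.exists_piece (Ico_subset_Icc_self ht)
  simp only [mem_iUnion]
  refine ⟨p.1, q.1, x, hp.left_mem, y, hp.right_mem, x', hp'.left_mem, y', hp'.right_mem,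
    hp, hp', s, hsx, t, htx, c, hps, ?_, ?_⟩
  · rwa [← hqt]
  · rwa [← hqt, ← hps]

theorem IsGoodDirection.param_notMem {S : Set ℝ} {L : Circles m → R3}
    (hinj : Function.Injective L) {M : R3} (hM : IsGoodDirection S L M) {p : Circles m}
    (hp : p ∈ chordEnds L M) : param p ∉ S := by
  intro hpS
  obtain ⟨q, hpq, c, hc⟩ := hp
  have := hM.vertex p.1 q.1 (param p) hpS (Ico_subset_Icc_self (param_mem p)) (param q)
    (Ico_subset_Icc_self (param_mem q)) c (by rwa [coe_param, coe_param])
  rw [coe_param, coe_param] at this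
  exact hpq (hinj this)

/-- There is a start time, depending on the point, which is PL in the point and separates the
points of a finite set. -/
theorem exists_startTime {Q : Set (Circles m)} (hQ : Q.Finite) :
    ∃ (r : ℝ) (θ : Circles m → ℝ), AffineOff {r} θ ∧ (∀ p ∈ Q, param p ≠ r) ∧
      (∀ p, 0 ≤ θ p) ∧ (∀ p, θ p ≤ 1 / 2) ∧ InjOn θ Q := by
  obtain ⟨K₀, hK₀⟩ := (hQ.image fun p => param p / (1 - param p)).bddAbove
  -- With this slope all of `Q` lies on the rising part of the tent, where its value is the
  -- parameter in `[0, 1)`. Adding the index of the circle then separates the points of `Q`.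
  let K := max K₀ 0 + 1
  have hK : 0 < K := by positivity
  have hQK : ∀ p ∈ Q, param p < K * (1 - param p) := by
    intro p hp
    have h1 := hK₀ ⟨p, hp, rfl⟩
    have h2 := (param_mem p).2
    rw [← div_lt_iff₀ (by linarith)]
    exact h1.trans_lt (lt_of_le_of_lt (le_max_left _ _) (lt_add_one _))
  have hm : (0 : ℝ) < 2 * (m + 1) := by positivity
  refine ⟨K / (K + 1), fun p => (2 * ((m : ℝ) + 1))⁻¹ * (((p.1 : ℕ) : ℝ) + tent K p),
    (affineOff_fst.add (affineOff_tent hK)).linear (LinearMap.mulLeft ℝ _), ?_, ?_, ?_, ?_⟩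
  · intro p hp heq
    have := hQK p hp
    rw [heq] at this
    field_simp at this
    simp at this
  · intro p
    have := tent_nonneg hK.le p
    positivity
  · intro p
    have h1 : ((p.1 : ℕ) : ℝ) ≤ m := by exact_mod_cast p.1.2.le
    have h2 := tent_le_one K p
    rw [inv_mul_le_iff₀ hm]
    linarith
  · intro p hp q hq heq
    have h1 := mul_left_cancel₀ (inv_ne_zero hm.ne') heq
    simp only [tent, min_eq_left (hQK p hp).le, min_eq_left (hQK q hq).le] at h1
    have hp1 := param_mem p
    have hq1 := param_mem q
    have h2 : (p.1 : ℕ) = q.1 := by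
      have h3 : ((p.1 : ℕ) : ℝ) < (q.1 : ℕ) + 1 := by linarith [hp1.1, hq1.2]
      have h4 : ((q.1 : ℕ) : ℝ) < (p.1 : ℕ) + 1 := by linarith [hq1.1, hp1.2]
      norm_cast at h3 h4
      omega
    rw [h2] at h1
    rw [← coe_param p, ← coe_param q, add_left_cancel h1, Fin.ext h2]

/-- A motion over a distance at most `B` lasts at most `B / N`. This should be less than the gaps
between start times in `Q`, and at most `1 / 2` so that all motions end by time `1`. -/
theorem exists_speed {X : Type*} {Q : Set X} (hQ : Q.Finite) {θ : X → ℝ} (hθ : InjOn θ Q)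
    (B : ℝ) : ∃ N : ℝ, 0 < N ∧ 2 * B ≤ N ∧ ∀ p ∈ Q, ∀ q ∈ Q, p ≠ q → B < N * |θ p - θ q| := by
  obtain ⟨N₀, hN₀⟩ := ((hQ.prod hQ).image fun w => B / |θ w.1 - θ w.2|).bddAbove
  refine ⟨max (max N₀ (2 * B)) 0 + 1, by positivity, ?_, ?_⟩
  · linarith [le_max_right N₀ (2 * B), le_max_left (max N₀ (2 * B)) 0]
  · intro p hp q hq hpq
    have h1 := hN₀ ⟨(p, q), ⟨hp, hq⟩, rfl⟩
    have h2 : 0 < |θ p - θ q| := abs_pos.2 (sub_ne_zero.2 fun h => hpq (hθ hp hq h))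
    rw [← div_lt_iff₀ h2]
    simp only at h1
    linarith [le_max_left N₀ (2 * B), le_max_left (max N₀ (2 * B)) 0]

/-- The change of vectors is triangular. It is applied to the tangents of the two sheets, which are
edges of `L` corrected by multiples of `M`, and to the relative velocity, a multiple of `M`. -/
theorem linearIndependent_add_smul {E F M : R3} (h : LinearIndependent ℝ ![E, F, M]) (a b : ℝ)
    {c : ℝ} (hc : c ≠ 0) : LinearIndependent ℝ ![E + a • M, F + b • M, c • M] := by
  rw [Fintype.linearIndependent_iff]
  intro g hg
  simp only [Fin.sum_univ_three, Matrix.cons_val_zero, Matrix.cons_val_one, Matrix.cons_val] at hg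
  obtain ⟨h0, h1, h2⟩ := smul_eq_zero_of_linearIndependent h
    (a := g 0) (b := g 1) (c := g 0 * a + g 1 * b + g 2 * c) (by rw [← hg]; module)
  intro i
  fin_cases i
  · exact h0
  · exact h1
  · simpa [h0, h1, hc] using h2

theorem IsGoodDirection.hasSlope {S T : Set ℝ} (hS : IsBreakSet S) (hT : IsBreakSet T)
    {L : Circles m → R3} (hL : AffineOff S L) (hinj : Function.Injective L) {M : R3}
    (hM : IsGoodDirection S L M) {φ θ : Circles m → ℝ} (hφ : AffineOff S φ) (hθ : AffineOff T θ)
    (hT' : ∀ p ∈ chordEnds L M, param p ∉ T) {p q : Circles m} (hpq : p ≠ q) {c : ℝ}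
    (hc : L p - L q = c • M) :
    ∃ (u u' : R3) (b b' d d' : ℝ), HasSlope L p u ∧ HasSlope L q u' ∧ HasSlope φ p b ∧
      HasSlope φ q b' ∧ HasSlope θ p d ∧ HasSlope θ q d' ∧ LinearIndependent ℝ ![u, u', M] := by
  have key : ∀ p ∈ chordEnds L M, ∃ x y x' y', IsPiece S x y ∧ IsPiece T x' y' ∧
      param p ∈ Icc x y ∧ HasSlope L p (slopeOn L p.1 x y) ∧ HasSlope φ p (slopeOn φ p.1 x y) ∧
      HasSlope θ p (slopeOn θ p.1 x' y') := by
    intro p hp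
    have h1 := Ico_subset_Icc_self (param_mem p)
    obtain ⟨x, y, hxy, hpx⟩ := hS.exists_piece h1
    obtain ⟨x', y', hxy', hpx'⟩ := hT.exists_piece h1
    have hL' := hL.hasSlope hxy (hxy.mem_Ioo hpx (hM.param_notMem hinj hp)) p.1
    have hφ' := hφ.hasSlope hxy (hxy.mem_Ioo hpx (hM.param_notMem hinj hp)) p.1
    have hθ' := hθ.hasSlope hxy' (hxy'.mem_Ioo hpx' (hT' p hp)) p.1
    rw [coe_param] at hL' hφ' hθ'
    exact ⟨x, y, x', y', hxy, hxy', hpx, hL', hφ', hθ'⟩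
  obtain ⟨x, y, _, _, h1, -, h2, h3, h4, h5⟩ := key p ⟨q, hpq, c, hc⟩
  obtain ⟨x', y', _, _, h1', -, h2', h3', h4', h5'⟩ := key q (mem_chordEnds_right hpq hc)
  refine ⟨_, _, _, _, _, _, h3, h3', h4, h4', h5, h5', ?_⟩
  refine hM.indep p.1 q.1 x y x' y' h1 h1' (param p) h2 (param q) h2' c ?_ ?_
  · rwa [coe_param, coe_param]
  · rw [coe_param, coe_param]
    exact fun h => hpq (hinj h)

/-- A link can be pushed along almost every vector by a generic PL homotopy. -/
theorem exists_isGenericPLHomotopy {S : Set ℝ} (hS : IsBreakSet S) {L : Circles m → R3}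
    (hL : AffineOff S L) (hinj : Function.Injective L) {φ : Circles m → ℝ} (hφ : AffineOff S φ)
    (hφ0 : ∀ p, 0 ≤ φ p) {B : ℝ} (hB : ∀ p, φ p ≤ B) {M : R3} (hM : IsGoodDirection S L M)
    (hsep : IsSeparated L φ M) :
    ∃ l : unitInterval → Circles m → R3, IsGenericPLHomotopy l ∧ l 0 = L ∧
      (l 1 = fun p => L p + φ p • M) ∧ ∀ t p, ∃ g ∈ Icc 0 (φ p), l t p = L p + g • M := by
  have hQ := finite_chordEnds hS hL hinj hM
  set Q := chordEnds L M with hQdef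
  obtain ⟨r, θ, hθ, hr, hθ0, hθ2, hθinj⟩ := exists_startTime hQ
  obtain ⟨N, hN, hBN, hgap⟩ := exists_speed hQ hθinj B
  have hT : IsBreakSet (S ∪ {r}) := hS.union (finite_singleton r)
  have hθT : AffineOff (S ∪ {r}) θ := hθ.mono subset_union_right
  have hQT : ∀ p ∈ Q, param p ∉ S ∪ {r} := by
    rintro p hp (h | h)
    · exact hM.param_notMem hinj hp h
    · exact hr p hp h
  have hφN : ∀ p, φ p ≤ N / 2 := fun p => (hB p).trans (by linarith)
  have hzero : push L φ θ N M 0 = L := by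
    ext1 p
    rw [push, pushAmount_of_le, zero_smul, add_zero]
    exact mul_nonpos_of_nonneg_of_nonpos hN.le (by simpa using hθ0 p)
  have hone : push L φ θ N M 1 = fun p => L p + φ p • M := by
    ext1 p
    rw [push, pushAmount_of_ge (hφ0 p)]
    have := hθ2 p
    have h1 := hφN p
    rw [Icc.coe_one]
    nlinarith
  have honeinj : Function.Injective (push L φ θ N M 1) := by
    rw [hone]
    intro p q h
    by_contra hpq
    exact hsep p q hpq _ (Or.inr rfl) _ (Or.inr rfl) h
  have hmem : ∀ t p, pushAmount φ θ N t p ∈ Icc 0 (φ p) := fun t p =>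
    ⟨le_max_left _ _, max_le (hφ0 p) (min_le_right _ _)⟩
  have hcases : ∀ (t : ℝ) p, pushAmount φ θ N t p ∈ ({0, φ p} : Set ℝ) ∨
      (0 < N * (t - θ p) ∧ N * (t - θ p) < φ p) := by
    intro t p
    rcases le_or_gt (N * (t - θ p)) 0 with h | h
    · exact Or.inl (Or.inl (pushAmount_of_le h))
    · rcases le_or_gt (φ p) (N * (t - θ p)) with h' | h'
      · exact Or.inl (Or.inr (pushAmount_of_ge (hφ0 p) h'))
      · exact Or.inr ⟨h, h'⟩
  -- While one point of `Q` moves, the others rest. The inequalities for `p` are strict, so `p`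
  -- rests at all times near `t`, as affineness near `p` requires.
  have hstill : ∀ (t : ℝ), ∀ p ∈ Q, ∀ q ∈ Q, p ≠ q → 0 < N * (t - θ q) → N * (t - θ q) < φ q →
      N * (t - θ p) < 0 ∨ φ p < N * (t - θ p) := by
    intro t p hp q hq hpq h0 h1
    by_contra! hcon
    have h2 := hgap p hp q hq hpq
    have h3 : N * |θ p - θ q| ≤ B := by
      have h4 : N * |θ p - θ q| = |N * (θ p - θ q)| := by rw [abs_mul, abs_of_pos hN]
      rw [h4, abs_le]
      constructor <;> linarith [hB p, hB q, hcon.1, hcon.2]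
    linarith
  have hstill' : ∀ (t : ℝ), ∀ p ∈ Q, ∀ q ∈ Q, p ≠ q → 0 < N * (t - θ q) → N * (t - θ q) < φ q →
      pushAmount φ θ N t p ∈ ({0, φ p} : Set ℝ) := by
    intro t p hp q hq hpq h0 h1
    rcases hstill t p hp q hq hpq h0 h1 with h | h
    · exact Or.inl (pushAmount_of_le h.le)
    · exact Or.inr (pushAmount_of_ge (hφ0 p) h.le)
  have hchord : ∀ {t : unitInterval} {p q : Circles m}, push L φ θ N M t p = push L φ θ N M t q →
      L p - L q = (pushAmount φ θ N t q - pushAmount φ θ N t p) • M := by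
    intro t p q h
    rw [push, push] at h
    rw [sub_smul, sub_eq_sub_iff_add_eq_add, h, add_comm]
  have hpair : ∀ {t : unitInterval} {p q : Circles m}, p ≠ q →
      push L φ θ N M t p = push L φ θ N M t q →
      (0 < N * (t - θ p) ∧ N * (t - θ p) < φ p) ∨ (0 < N * (t - θ q) ∧ N * (t - θ q) < φ q) := by
    intro t p q hpq h
    rcases hcases t p with hp | hp
    · rcases hcases t q with hq | hq
      · exact absurd h (hsep p q hpq _ hp _ hq)
      · exact Or.inr hq
    · exact Or.inl hp
  have hsing : ∀ t : unitInterval, ¬ Function.Injective (push L φ θ N M t) →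
      ∃ p q, p ≠ q ∧ push L φ θ N M t p = push L φ θ N M t q ∧ 0 < N * (t - θ q) ∧
        N * (t - θ q) < φ q := by
    intro t ht
    simp only [Function.Injective, not_forall] at ht
    obtain ⟨p, q, h, hpq⟩ := ht
    rcases hpair hpq h with h1 | h1
    · exact ⟨q, p, Ne.symm hpq, h.symm, h1.1, h1.2⟩
    · exact ⟨p, q, hpq, h, h1.1, h1.2⟩
  refine ⟨push L φ θ N M, ⟨?_, ?_, honeinj, ?_, ?_⟩, hzero, hone, fun t p => ⟨_, hmem t p, rfl⟩⟩
  · refine isPLHomotopy_push hT (hL.mono subset_union_left) (hφ.mono subset_union_left) hθT hφ0 hθ0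
      hN fun p => ?_
    have : φ p / N ≤ 1 / 2 := by
      rw [div_le_iff₀ hN]
      linarith [hφN p]
    linarith [hθ2 p]
  · rw [hzero]; exact hinj
  · have hfin : (⋃ p ∈ Q, ⋃ q ∈ Q, ⋃ c ∈ ({0, φ p} : Set ℝ),
        {t : unitInterval | p ≠ q ∧ L p + c • M = L q + (N * (t - θ q)) • M}).Finite := by
      -- For given `p`, `q` and resting position of `p`, the point `q` passes that position only
      -- once, as its speed is constant and nonzero.
      refine hQ.biUnion fun p _ => hQ.biUnion fun q _ =>
        (toFinite ({0, φ p} : Set ℝ)).biUnion fun c _ => Subsingleton.finite ?_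
      rintro t ⟨hpq, ht⟩ t' ⟨-, ht'⟩
      have hM0 : M ≠ 0 := by
        rintro rfl
        simp only [smul_zero, add_zero] at ht
        exact hpq (hinj ht)
      have h1 := smul_left_injective ℝ hM0 (add_left_cancel (ht.symm.trans ht'))
      have h2 := mul_left_cancel₀ hN.ne' h1
      exact Subtype.ext (by linarith)
    refine hfin.subset fun t ht => ?_
    obtain ⟨p, q, hpq, h, h0, h1⟩ := hsing t ht
    have hc := hchord h
    have hpQ : p ∈ Q := ⟨q, hpq, _, hc⟩
    have hqQ : q ∈ Q := mem_chordEnds_right hpq hc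
    simp only [mem_iUnion]
    refine ⟨p, hpQ, q, hqQ, _, hstill' t p hpQ q hqQ hpq h0 h1, hpq, ?_⟩
    rw [push, push, pushAmount_of_mem (p := q) h0.le h1.le] at h
    exact h
  · intro t ht
    obtain ⟨p, q, hpq, h, h0, h1⟩ := hsing t ht
    have hc := hchord h
    have hpQ : p ∈ Q := ⟨q, hpq, _, hc⟩
    have hqQ : q ∈ Q := mem_chordEnds_right hpq hc
    -- A third point over the double point would rest there together with `p`, contrary to
    -- separation.
    have huniq : ∀ a, a ≠ q → push L φ θ N M t a = push L φ θ N M t q → a = p := by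
      intro a ha heq
      by_contra hap
      have haQ : a ∈ Q := ⟨q, ha, _, hchord heq⟩
      exact hsep a p hap _ (hstill' t a haQ q hqQ ha h0 h1) _ (hstill' t p hpQ q hqQ hpq h0 h1)
        (heq.trans h.symm)
    have ht01 : (t : ℝ) ∈ Ioo 0 1 := by
      refine ⟨t.2.1.lt_of_ne fun h' => ht ?_, t.2.2.lt_of_ne fun h' => ht ?_⟩
      · rw [show t = 0 from Subtype.ext h'.symm, hzero]
        exact hinj
      · rw [show t = 1 from Subtype.ext h']
        exact honeinj
    refine ⟨push L φ θ N M t q, p, q, ⟨hpq, ?_, ?_⟩, ?_⟩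
    · ext a
      constructor
      · intro ha
        by_cases haq : a = q
        · exact Or.inr haq
        · exact Or.inl (huniq a haq ha)
      · rintro (rfl | rfl)
        · exact h
        · rfl
    -- A second double point would have two preimages in `Q`, neither of them `q`; both would be at
    -- rest, contrary to separation.
    · intro y hy a ha b hb
      by_contra hab
      have hab' : push L φ θ N M t a = push L φ θ N M t b := Eq.trans ha (Eq.symm hb)
      have hne : ∀ c, push L φ θ N M t c = y → c ≠ q := fun c hc hcq => hy (by rw [← hc, hcq])
      have hcab := hchord hab'
      have haQ : a ∈ Q := ⟨b, hab, _, hcab⟩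
      have hbQ : b ∈ Q := mem_chordEnds_right hab hcab
      exact hsep a b hab _ (hstill' t a haQ q hqQ (hne a ha) h0 h1) _
        (hstill' t b hbQ q hqQ (hne b hb) h0 h1) hab'
    · obtain ⟨u, u', b, b', d, d', hu, hu', hb, hb', hd, hd', hli⟩ :=
        hM.hasSlope hS hT hL hinj hφ hθT hQT hpq hc
      have hq := isAffineNear_push_during (M := M) ht01 hu' hd' hb' h0 h1
      have hind : ∀ x : ℝ, LinearIndependent ℝ
          ![u + x • M, u' + (-(N * d')) • M, (0 : ℝ) • M - N • M] := by
        intro x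
        rw [← sub_smul]
        exact linearIndependent_add_smul hli _ _ (by linarith)
      rcases hstill t p hpQ q hqQ hpq h0 h1 with hp | hp
      · exact ⟨_, _, _, _, isAffineNear_push_before ht01 hu hd hp, hq, hind _⟩
      · exact ⟨_, _, _, _, isAffineNear_push_after hφ0 ht01 hu hd hb hp, hq, hind _⟩

end

/-! ### Joining nearby polygonal links by pushes -/

section

variable {m : ℕ}

/-- An embedding which is affine off a finite set of parameters. -/
def IsPolygonalLink (L : Circles m → R3) : Prop :=
  (∃ S, IsBreakSet S ∧ AffineOff S L) ∧ Function.Injective L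

theorem IsPLLink.isPolygonalLink {L : Circles m → R3} (hL : IsPLLink L) : IsPolygonalLink L :=
  ⟨hL.1.exists_affineOff, hL.2⟩

theorem IsTopLink.isTopIsotopy {L : Circles m → R3} (hL : IsTopLink L) :
    IsTopIsotopy fun _ => L :=
  ⟨hL.1.comp continuous_snd, fun _ => hL.2⟩

theorem IsTopIsotopy.isTopLink {h : unitInterval → Circles m → R3} (hh : IsTopIsotopy h)
    (t : unitInterval) : IsTopLink (h t) :=
  ⟨hh.1.comp (f := fun p => (t, p)) (by fun_prop), hh.2 t⟩

theorem injective_add_smul {L : Circles m → R3} {φ : Circles m → ℝ} {M : R3}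
    (h : IsSeparated L φ M) : Function.Injective fun p => L p + φ p • M := by
  intro p q hpq
  by_contra hne
  exact h p q hne _ (Or.inr rfl) _ (Or.inr rfl) hpq

section Chain

variable {k : ℕ} {L : Circles m → R3} {ε : ℝ}

/-- Every generic PL homotopy which stays `ε`-close to `L` is a strong `k`-quasi-isotopy. -/
def IsControlled (k : ℕ) (L : Circles m → R3) (ε : ℝ) : Prop :=
  ∀ l : unitInterval → Circles m → R3, IsGenericPLHomotopy l →
    (∀ t p, dist (l t p) (L p) < ε) → IsStrongQuasiIsotopy k l

theorem IsControlled.push (hε : IsControlled k L ε) {S : Set ℝ} (hS : IsBreakSet S)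
    {L₀ : Circles m → R3} (hL₀ : AffineOff S L₀) (hinj : Function.Injective L₀)
    {φ : Circles m → ℝ} (hφ : AffineOff S φ) (hφ0 : ∀ p, 0 ≤ φ p) {B : ℝ} (hB : ∀ p, φ p ≤ B)
    {M : R3} (hM : IsGoodDirection S L₀ M) (hsep : IsSeparated L₀ φ M) {ρ : ℝ}
    (hρ : ∀ p, dist (L₀ p) (L p) ≤ ρ) (hlt : ρ + B * ‖M‖ < ε) :
    StronglyQuasiIsotopic k L₀ fun p => L₀ p + φ p • M := by
  obtain ⟨l, h1, h2, h3, h4⟩ := exists_isGenericPLHomotopy hS hL₀ hinj hφ hφ0 hB hM hsep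
  refine ⟨l, hε l h1 fun t p => ?_, h2, h3⟩
  obtain ⟨g, hg, heq⟩ := h4 t p
  rw [heq]
  have e1 := dist_triangle (L₀ p + g • M) (L₀ p) (L p)
  rw [dist_self_add_left, norm_smul, Real.norm_of_nonneg hg.1] at e1
  have e2 := mul_le_mul_of_nonneg_right (hg.2.trans (hB p)) (norm_nonneg M)
  linarith [hρ p]

theorem exists_norm_lt_of_ae {P : R3 → Prop} (h : ∀ᵐ M, P M) {δ : ℝ} (hδ : 0 < δ) :
    ∃ M, ‖M‖ < δ ∧ P M := by
  obtain ⟨M, hM, hd⟩ := (Measure.dense_of_ae h).exists_dist_lt 0 hδ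
  exact ⟨M, by rwa [dist_zero_left] at hd, hM⟩

/-- Each step removes one term `φ • c` from the difference by pushing `L₀` along `c + M` and `L₁`
along `M`. With `‖M‖ < 1` both displacements are at most `B * (‖c‖ + 1)`, which is what the summed
bound pays for. -/
theorem IsControlled.stronglyQuasiIsotopic_of_list (hε : IsControlled k L ε) {S : Set ℝ}
    (hS : IsBreakSet S) (Φ : List ((Circles m → ℝ) × R3 × ℝ))
    (hΦ : ∀ e ∈ Φ, AffineOff S e.1 ∧ 0 ≤ e.2.2 ∧ ∀ p, e.1 p ∈ Icc 0 e.2.2) :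
    ∀ (L₀ L₁ : Circles m → R3) (ρ : ℝ), AffineOff S L₀ → AffineOff S L₁ →
      Function.Injective L₀ → Function.Injective L₁ → (∀ p, dist (L₀ p) (L p) ≤ ρ) →
      (∀ p, dist (L₁ p) (L p) ≤ ρ) →
      (∀ p, L₁ p = L₀ p + (Φ.map fun e => e.1 p • e.2.1).sum) →
      ρ + (Φ.map fun e => e.2.2 * (‖e.2.1‖ + 1)).sum < ε →
      StronglyQuasiIsotopic k L₀ L₁ := by
  induction Φ with
  | nil =>
    intro L₀ L₁ ρ hL₀ _ hinj _ hρ _ heq hlt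
    -- The links coincide here, and a push by the amount zero is a generic homotopy from the link to
    -- itself.
    have hφ : AffineOff S fun _ : Circles m => (0 : ℝ) := AffineOff.const 0
    obtain ⟨M, h1, h2⟩ := ((ae_isGoodDirection hS hL₀).and
      (ae_isSeparated hS hL₀ hinj hφ)).exists
    have := hε.push hS hL₀ hinj hφ (fun _ => le_rfl) (B := 0) (fun _ => le_rfl) h1 h2 hρ
      (by simpa using hlt)
    convert this using 2 with p
    simp [heq]
  | cons e Φ ih =>
    intro L₀ L₁ ρ hL₀ hL₁ hinj₀ hinj₁ hρ₀ hρ₁ heq hlt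
    obtain ⟨φ, c, B⟩ := e
    obtain ⟨hφ, hB, hφB⟩ := hΦ _ List.mem_cons_self
    simp only at hφ hB hφB
    simp only [List.map_cons, List.sum_cons] at heq hlt
    -- Translation by `c` preserves null sets, so a single small `M` can serve both links.
    have hshift : ∀ᵐ M : R3, IsGoodDirection S L₀ (c + M) ∧ IsSeparated L₀ φ (c + M) :=
      (measurePreserving_add_left volume c).quasiMeasurePreserving.ae
        ((ae_isGoodDirection hS hL₀).and (ae_isSeparated hS hL₀ hinj₀ hφ))
    obtain ⟨M, hM, ⟨h1, h2⟩, h3, h4⟩ := exists_norm_lt_of_ae (hshift.and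
      ((ae_isGoodDirection hS hL₁).and (ae_isSeparated hS hL₁ hinj₁ hφ))) one_pos
    have hrest : 0 ≤ (Φ.map fun e => e.2.2 * (‖e.2.1‖ + 1)).sum := by
      apply List.sum_nonneg
      simp only [List.mem_map]
      rintro _ ⟨e, he, rfl⟩
      exact mul_nonneg (hΦ e (List.mem_cons_of_mem _ he)).2.1 (by positivity)
    have hnorm : ∀ N : R3, ‖N‖ ≤ ‖c‖ + 1 → ∀ (K : Circles m → R3), (∀ p, dist (K p) (L p) ≤ ρ) →
        ρ + B * ‖N‖ < ε ∧ ∀ p, dist (K p + φ p • N) (L p) ≤ ρ + B * (‖c‖ + 1) := by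
      intro N hN K hK
      have e1 := mul_le_mul_of_nonneg_left hN hB
      refine ⟨by linarith, fun p => ?_⟩
      have e2 := dist_triangle (K p + φ p • N) (K p) (L p)
      rw [dist_self_add_left, norm_smul, Real.norm_of_nonneg (hφB p).1] at e2
      have e3 := mul_le_mul_of_nonneg_right (hφB p).2 (norm_nonneg N)
      linarith [hK p]
    obtain ⟨n1, n2⟩ := hnorm (c + M) ((norm_add_le c M).trans (by linarith)) L₀ hρ₀
    obtain ⟨n3, n4⟩ := hnorm M (by linarith [norm_nonneg c]) L₁ hρ₁
    have s1 := hε.push hS hL₀ hinj₀ hφ (fun p => (hφB p).1) (fun p => (hφB p).2) h1 h2 hρ₀ n1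
    have s2 := hε.push hS hL₁ hinj₁ hφ (fun p => (hφB p).1) (fun p => (hφB p).2) h3 h4 hρ₁ n3
    refine s1.trans (StronglyQuasiIsotopic.trans ?_ s2.symm)
    refine ih (fun e he => hΦ e (List.mem_cons_of_mem _ he)) _ _ _ (hL₀.add (hφ.smul_const _))
      (hL₁.add (hφ.smul_const _)) (injective_add_smul h2) (injective_add_smul h4) n2 n4 ?_
      (by linarith)
    intro p
    simp only [heq]
    module

theorem IsControlled.exists_stronglyQuasiIsotopic (hε : IsControlled k L ε) (hpos : 0 < ε) :
    ∃ δ > 0, ∀ L₀ L₁ : Circles m → R3, IsPolygonalLink L₀ → IsPolygonalLink L₁ →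
      (∀ p, dist (L₀ p) (L p) < δ) → (∀ p, dist (L₁ p) (L p) < δ) →
      StronglyQuasiIsotopic k L₀ L₁ := by
  let e : Fin 3 → R3 := fun i => EuclideanSpace.single i 1
  let o : R3 := WithLp.toLp 2 fun _ => -1
  let C : ℝ := 2 * (‖e 0‖ + 1) + 2 * (‖e 1‖ + 1) + 2 * (‖e 2‖ + 1) + (‖o‖ + 1)
  have hC : 0 < C := by positivity
  have hδ : 0 < ε / (2 + 2 * C) := by positivity
  refine ⟨ε / (2 + 2 * C), hδ, ?_⟩
  rintro L₀ L₁ ⟨⟨S, hS, hL₀⟩, hinj₀⟩ ⟨⟨T, hT, hL₁⟩, hinj₁⟩ hd₀ hd₁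
  set δ := ε / (2 + 2 * C) with hδdef
  have hST : IsBreakSet (S ∪ T) := hS.union hT.finite
  replace hL₀ := hL₀.mono (subset_union_left (s := S) (t := T))
  replace hL₁ := hL₁.mono (subset_union_right (s := S) (t := T))
  -- The shift makes the coordinates of the difference nonnegative, as pushes require; the constant
  -- push along `o` takes it back.
  let φ : Fin 3 → Circles m → ℝ := fun i p => (L₁ p - L₀ p) i + 2 * δ
  have hφ : ∀ i, AffineOff (S ∪ T) (φ i) := fun i =>
    ((hL₁.sub hL₀).linear (EuclideanSpace.proj (𝕜 := ℝ) i).toLinearMap).add (AffineOff.const _)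
  have hφB : ∀ i p, φ i p ∈ Icc 0 (2 * δ * 2) := by
    intro i p
    have h1 := PiLp.norm_apply_le (L₁ p - L₀ p) i
    rw [← dist_eq_norm, Real.norm_eq_abs] at h1
    have h2 := abs_le.1 (h1.trans (dist_triangle_right (L₁ p) (L₀ p) (L p)))
    constructor <;> simp only [φ] <;> linarith [hd₀ p, hd₁ p, h2.1, h2.2]
  refine hε.stronglyQuasiIsotopic_of_list hST [(φ 0, e 0, 2 * δ * 2), (φ 1, e 1, 2 * δ * 2),
    (φ 2, e 2, 2 * δ * 2), (fun _ => 2 * δ, o, 2 * δ)] ?_ L₀ L₁ δ hL₀ hL₁ hinj₀ hinj₁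
    (fun p => (hd₀ p).le) (fun p => (hd₁ p).le) ?_ ?_
  · have h4 : 0 ≤ 2 * δ * 2 := by positivity
    have h2 : 0 ≤ 2 * δ := by positivity
    simp only [List.forall_mem_cons, List.not_mem_nil, false_imp_iff, implies_true, and_true]
    exact ⟨⟨hφ 0, h4, hφB 0⟩, ⟨hφ 1, h4, hφB 1⟩, ⟨hφ 2, h4, hφB 2⟩, AffineOff.const _, h2,
      fun _ => ⟨h2, le_rfl⟩⟩
  · intro p
    ext i
    simp only [List.map_cons, List.map_nil, List.sum_cons, List.sum_nil]
    fin_cases i <;> simp [φ, e, o]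
  · simp only [List.map_cons, List.map_nil, List.sum_cons, List.sum_nil]
    have h1 : δ * (2 + 2 * C) = ε := div_mul_cancel₀ _ (by positivity)
    have h2 : δ + (2 * δ * 2 * (‖e 0‖ + 1) + (2 * δ * 2 * (‖e 1‖ + 1) + (2 * δ * 2 * (‖e 2‖ + 1) +
        (2 * δ * (‖o‖ + 1) + 0)))) = δ * (1 + 2 * C) := by
      simp only [C]; ring
    rw [h2, ← h1]
    linarith

end Chain

theorem IsTopLink.exists_stronglyQuasiIsotopic {L : Circles m → R3} (hL : IsTopLink L) (k : ℕ) :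
    ∃ ε > 0, ∀ L₀ L₁ : Circles m → R3, IsPolygonalLink L₀ → IsPolygonalLink L₁ →
      (∀ p, dist (L₀ p) (L p) < ε) → (∀ p, dist (L₁ p) (L p) < ε) →
      StronglyQuasiIsotopic k L₀ L₁ := by
  obtain ⟨ε, hε, H⟩ := hL.isTopIsotopy.exists_forall_isStrongQuasiIsotopy k
  exact IsControlled.exists_stronglyQuasiIsotopic H hε

/-! ### Polygonal approximation of topological links -/

section Approximation

/-- The polygon with the vertices `F (i, j / n)`. -/
noncomputable def polygon (F : Circles m → R3) (n : ℕ) (p : Circles m) : R3 :=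
  (1 - Int.fract (n * param p)) • F (p.1, ((⌊n * param p⌋ / n : ℝ) : UnitAddCircle)) +
    Int.fract (n * param p) • F (p.1, (((⌊n * param p⌋ + 1) / n : ℝ) : UnitAddCircle))

theorem polygon_node (F : Circles m → R3) {n : ℕ} (hn : 0 < n) (i : Fin m) {j : ℤ} (hj0 : 0 ≤ j)
    (hj : j ≤ n) : polygon F n (i, ((j / n : ℝ) : UnitAddCircle)) =
      F (i, ((j / n : ℝ) : UnitAddCircle)) := by
  have hn' : (0 : ℝ) < n := by exact_mod_cast hn
  have key : ∀ j : ℤ, 0 ≤ j → j < n → polygon F n (i, ((j / n : ℝ) : UnitAddCircle)) =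
      F (i, ((j / n : ℝ) : UnitAddCircle)) := by
    intro j hj0 hj
    have hp : param ((i, ((j / n : ℝ) : UnitAddCircle)) : Circles m) = j / n := by
      apply param_coe
      constructor
      · have : (0 : ℝ) ≤ j := by exact_mod_cast hj0
        positivity
      · rw [div_lt_one hn']
        exact_mod_cast hj
    have hmul : (n : ℝ) * (j / n) = j := mul_div_cancel₀ _ hn'.ne'
    simp [polygon, hp, hmul]
  rcases hj.lt_or_eq with h | h
  · exact key j hj0 h
  -- At `j = n` the point of the circle has parameter `0`, so the claim is the one for `j = 0`.
  · have h1 : (j / n : ℝ) = 1 := by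
      rw [h]
      simp [hn'.ne']
    rw [h1, coe_one_eq_zero]
    simpa using key 0 le_rfl (by exact_mod_cast hn)

theorem polygon_coe (F : Circles m → R3) {n : ℕ} (hn : 0 < n) (i : Fin m) {j : ℤ} (hj0 : 0 ≤ j)
    (hj : j < n) {s : ℝ} (hs : s ∈ Icc (j / n : ℝ) ((j + 1) / n)) :
    polygon F n (i, (s : UnitAddCircle)) =
      (j + 1 - n * s) • F (i, ((j / n : ℝ) : UnitAddCircle)) +
        (n * s - j) • F (i, (((j + 1) / n : ℝ) : UnitAddCircle)) := by
  have hn' : (0 : ℝ) < n := by exact_mod_cast hn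
  have hj0' : (0 : ℝ) ≤ j := by exact_mod_cast hj0
  have hj' : (j : ℝ) + 1 ≤ n := by exact_mod_cast hj
  rcases hs.2.lt_or_eq with h | h
  · have h1 : param ((i, (s : UnitAddCircle)) : Circles m) = s := by
      apply param_coe
      refine ⟨le_trans (by positivity) hs.1, h.trans_le ?_⟩
      rw [div_le_one hn']
      exact hj'
    have h2 : ⌊(n : ℝ) * s⌋ = j := by
      rw [Int.floor_eq_iff]
      have h3 := hs.1
      rw [div_le_iff₀ hn'] at h3
      rw [lt_div_iff₀ hn'] at h
      constructor <;> linarith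
    rw [polygon, h1, Int.fract, h2]
    congr 2
    ring
  · have := polygon_node F hn i (j := j + 1) (by omega) (by omega)
    push_cast at this
    rw [h, this, mul_div_cancel₀ _ hn'.ne']
    simp

theorem exists_index {n : ℕ} (hn : 0 < n) {s : ℝ} (hs : s ∈ Ico (0 : ℝ) 1) :
    ∃ j : ℤ, 0 ≤ j ∧ j < n ∧ s ∈ Ico (j / n : ℝ) ((j + 1) / n) := by
  have hn' : (0 : ℝ) < n := by exact_mod_cast hn
  refine ⟨⌊n * s⌋, Int.floor_nonneg.2 (mul_nonneg hn'.le hs.1), ?_, ?_, ?_⟩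
  · rw [Int.floor_lt]
    push_cast
    nlinarith [hs.2]
  · rw [div_le_iff₀ hn', mul_comm]
    exact Int.floor_le _
  · rw [lt_div_iff₀ hn', mul_comm]
    exact Int.lt_floor_add_one _

theorem exists_affineOff_polygon (F : Circles m → R3) {n : ℕ} (hn : 0 < n) :
    ∃ S, IsBreakSet S ∧ AffineOff S (polygon F n) := by
  have hn' : (0 : ℝ) < n := by exact_mod_cast hn
  refine ⟨(fun j : ℤ => (j / n : ℝ)) '' Icc 0 n, ⟨(finite_Icc _ _).image _,
    ⟨0, by simp, by simp⟩, ⟨n, by simp, by simp [hn'.ne']⟩⟩, ?_⟩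
  intro i x y hx hxy hy hd
  obtain ⟨j, hj0, hj, hxj⟩ := exists_index hn ⟨hx, hxy.trans_le hy⟩
  have hyj : y ≤ (j + 1) / n := by
    by_contra hlt
    refine Set.disjoint_left.1 hd ⟨hxj.2, not_le.1 hlt⟩ ⟨j + 1, ⟨by omega, by omega⟩, ?_⟩
    push_cast
    rfl
  refine ⟨(j + 1 : ℝ) • F (i, ((j / n : ℝ) : UnitAddCircle)) -
    (j : ℝ) • F (i, (((j + 1) / n : ℝ) : UnitAddCircle)),
    (n : ℝ) • (F (i, (((j + 1) / n : ℝ) : UnitAddCircle)) - F (i, ((j / n : ℝ) : UnitAddCircle))),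
    fun s hs => ?_⟩
  rw [polygon_coe F hn i hj0 hj ⟨hxj.1.trans hs.1, hs.2.trans hyj⟩]
  module

theorem IsTopLink.exists_affineOff_dist_lt {L : Circles m → R3} (hL : IsTopLink L) {ε : ℝ}
    (hε : 0 < ε) :
    ∃ (S : Set ℝ) (K : Circles m → R3), IsBreakSet S ∧ AffineOff S K ∧ ∀ p, dist (K p) (L p) < ε := by
  obtain ⟨δ, hδ, H⟩ := hL.isTopIsotopy.exists_dist_lt hε
  obtain ⟨n, hnδ⟩ := exists_nat_gt (1 / δ)
  have hn' : (0 : ℝ) < n := lt_trans (by positivity) hnδ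
  have hn : 0 < n := by exact_mod_cast hn'
  obtain ⟨S, hS, hK⟩ := exists_affineOff_polygon L hn
  refine ⟨S, polygon L n, hS, hK, fun p => ?_⟩
  obtain ⟨j, hj0, hj, hs⟩ := exists_index hn (param_mem p)
  have hsmall : 1 / (n : ℝ) < δ := by
    rw [div_lt_comm₀ hn' hδ]
    exact hnδ
  have hsplit : ((j : ℝ) + 1) / n = j / n + 1 / n := add_div _ _ _
  have hnear : ∀ x : ℝ, |x - param p| ≤ δ → L (p.1, (x : UnitAddCircle)) ∈ Metric.ball (L p) ε := by
    intro x hx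
    have := H 0 p (x - param p) hx
    have hp : p.2 = (param p : UnitAddCircle) := (congrArg Prod.snd (coe_param p)).symm
    rwa [AddCircle.coe_sub, hp, add_sub_cancel] at this
  have hconv := convex_ball (L p) ε
  have h1 := hnear (j / n) (by rw [abs_le]; constructor <;> linarith [hs.1, hs.2])
  have h2 := hnear ((j + 1) / n) (by rw [abs_le]; constructor <;> linarith [hs.1, hs.2])
  have h3 := hs.1
  have h4 := hs.2
  rw [div_le_iff₀ hn'] at h3
  rw [lt_div_iff₀ hn'] at h4
  have h5 := polygon_coe L hn p.1 hj0 hj (Ico_subset_Icc_self hs)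
  rw [coe_param] at h5
  have := hconv h1 h2 (a := j + 1 - n * param p) (b := n * param p - j) (by linarith) (by linarith)
    (by ring)
  rwa [← h5] at this

/-- For generic small `M`, the map `K + φ • M` identifies two points only if both `K` and `φ` do.
Repeating this with functions that jointly separate points yields an embedding. -/
theorem exists_perturbation {S : Set ℝ} (hS : IsBreakSet S) {K : Circles m → R3}
    (hK : AffineOff S K) {φ : Circles m → ℝ} (hφ : AffineOff S φ) {B : ℝ} (hB : ∀ p, |φ p| ≤ B)
    {ε : ℝ} (hε : 0 < ε) :
    ∃ K' : Circles m → R3, AffineOff S K' ∧ (∀ p, dist (K' p) (K p) < ε) ∧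
      ∀ p q, K' p = K' q → φ p = φ q ∧ K p = K q := by
  obtain ⟨M, hM, h⟩ := exists_norm_lt_of_ae (ae_sub_ne_smul hS hK hφ hφ)
    (δ := ε / (|B| + 1)) (by positivity)
  refine ⟨fun p => K p + φ p • M, hK.add (hφ.smul_const M), fun p => ?_, fun p q heq => ?_⟩
  · rw [dist_self_add_left, norm_smul, Real.norm_eq_abs]
    have h1 : |φ p| < |B| + 1 := by linarith [hB p, le_abs_self B]
    rw [lt_div_iff₀ (by positivity)] at hM
    nlinarith [norm_nonneg M]
  · have key : K p - K q = (φ q - φ p) • M := by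
      rw [sub_smul, sub_eq_sub_iff_add_eq_add, add_comm _ (K q)]
      exact heq
    by_cases h0 : φ q - φ p = 0
    · rw [h0, zero_smul] at key
      exact ⟨(sub_eq_zero.1 h0).symm, sub_eq_zero.1 key⟩
    · exact absurd key (h p q h0)

/-- The symmetric tent confuses only `s` with `1 - s`, and the skew tent tells these apart when both
lie in `[0, 1)`. -/
theorem eq_of_tent_eq {p q : Circles m} (h1 : tent 1 p = tent 1 q) (h2 : tent 2 p = tent 2 q)
    (h3 : ((p.1 : ℕ) : ℝ) = (q.1 : ℕ)) : p = q := by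
  have h : param p = param q := by
    have hp := param_mem p
    have hq := param_mem q
    simp only [tent, min_def] at h1 h2
    split_ifs at h1 h2 <;> linarith [hp.1, hp.2, hq.1, hq.2]
  have h4 : p.1 = q.1 := Fin.ext (by exact_mod_cast h3)
  rw [← coe_param p, ← coe_param q, h, h4]

theorem IsTopLink.exists_isPolygonalLink {L : Circles m → R3} (hL : IsTopLink L) {ε : ℝ}
    (hε : 0 < ε) : ∃ K, IsPolygonalLink K ∧ ∀ p, dist (K p) (L p) < ε := by
  have hε4 : 0 < ε / 4 := by positivity
  obtain ⟨S, K, hS, hK, hd⟩ := hL.exists_affineOff_dist_lt hε4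
  let T : Set ℝ := S ∪ ({1 / (1 + 1)} ∪ {2 / (2 + 1)})
  have hT : IsBreakSet T := hS.union (toFinite _)
  have hB : ∀ (c : ℝ) (_ : 0 < c) (p : Circles m), |tent c p| ≤ 1 := fun c hc p =>
    abs_le.2 ⟨by linarith [tent_nonneg hc.le p], tent_le_one c p⟩
  obtain ⟨K₁, h1, d1, e1⟩ := exists_perturbation hT (hK.mono subset_union_left)
    ((affineOff_tent one_pos).mono (subset_union_left.trans subset_union_right))
    (hB 1 one_pos) hε4
  obtain ⟨K₂, h2, d2, e2⟩ := exists_perturbation hT h1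
    ((affineOff_tent two_pos).mono (subset_union_right.trans subset_union_right))
    (hB 2 two_pos) hε4
  obtain ⟨K₃, h3, d3, e3⟩ := exists_perturbation hT h2 (affineOff_fst (S := T)) (B := m)
    (fun p => by rw [abs_of_nonneg (Nat.cast_nonneg _)]; exact_mod_cast p.1.2.le) hε4
  refine ⟨K₃, ⟨⟨T, hT, h3⟩, fun p q h => ?_⟩, fun p => ?_⟩
  · obtain ⟨f3, g3⟩ := e3 p q h
    obtain ⟨f2, g2⟩ := e2 p q g3
    exact eq_of_tent_eq (e1 p q g2).1 f2 f3
  · have t1 := dist_triangle4 (K₃ p) (K₂ p) (K₁ p) (K p)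
    have t2 := dist_triangle (K₃ p) (K p) (L p)
    linarith [d1 p, d2 p, d3 p, hd p]

end Approximation

/-! ### Chaining along a topological isotopy -/

theorem IsTopIsotopy.eventually_dist_lt {h : unitInterval → Circles m → R3} (hh : IsTopIsotopy h)
    (t : unitInterval) {ε : ℝ} (hε : 0 < ε) :
    ∀ᶠ s in 𝓝 t, ∀ p, dist (h s p) (h t p) < ε := by
  have := (isCompact_univ (X := Circles m)).eventually_forall_of_forall_eventually (x₀ := t)
    (P := fun s p => dist (h s p) (h t p) < ε) fun p _ => ?_
  · simpa using this
  · have hc : Continuous fun z : unitInterval × Circles m => dist (h z.1 z.2) (h t z.2) :=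
      hh.1.dist ((hh.isTopLink t).1.comp continuous_snd)
    refine hc.continuousAt.eventually (gt_mem_nhds ?_)
    simpa using hε

theorem TopIsotopic.stronglyQuasiIsotopic {L₀ L₁ : Circles m → R3} (k : ℕ)
    (h₀ : IsPolygonalLink L₀) (h₁ : IsPolygonalLink L₁) (h : TopIsotopic L₀ L₁) :
    StronglyQuasiIsotopic k L₀ L₁ := by
  obtain ⟨h, hh, rfl, rfl⟩ := h
  choose ε hε H using fun t => (hh.isTopLink t).exists_stronglyQuasiIsotopic k
  -- The intermediate `h s` need not be PL, so the relation speaks of nearby polygonal links. By `H`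
  -- their choice is immaterial, which gives transitivity; locally one link close to both `h t` and
  -- `h s` suffices.
  let P : unitInterval → unitInterval → Prop := fun s t => ∃ K K', IsPolygonalLink K ∧
    IsPolygonalLink K' ∧ (∀ p, dist (K p) (h s p) < ε s) ∧ (∀ p, dist (K' p) (h t p) < ε t) ∧
    StronglyQuasiIsotopic k K K'
  have hsymm : Std.Symm P := ⟨fun s t ⟨K, K', a, b, c, d, e⟩ => ⟨K', K, b, a, d, c, e.symm⟩⟩
  have htrans : IsTrans unitInterval P := by
    refine ⟨fun s t u => ?_⟩
    rintro ⟨K, K', a, b, c, d, e⟩ ⟨K₂, K₂', a', b', c', d', e'⟩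
    exact ⟨K, K₂', a, b', c, d', e.trans ((H t K' K₂ b a' d c').trans e')⟩
  have hloc : ∀ t, ∀ᶠ s in 𝓝 t, P t s := by
    intro t
    have ht := hε t
    filter_upwards [hh.eventually_dist_lt t (half_pos ht)] with s hs
    obtain ⟨K, hK, hd⟩ := (hh.isTopLink s).exists_isPolygonalLink (lt_min (hε s) (half_pos ht))
    have hKt : ∀ p, dist (K p) (h t p) < ε t := fun p => by
      have h1 := (hd p).trans_le (min_le_right _ _)
      linarith [dist_triangle (K p) (h s p) (h t p), hs p]
    exact ⟨K, K, hK, hK, hKt, fun p => (hd p).trans_le (min_le_left _ _), H t K K hK hK hKt hKt⟩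
  obtain ⟨K, K', a, b, c, d, e⟩ := PreconnectedSpace.induction₂ P hloc htrans 0 1
  exact (H 0 _ K h₀ a (fun p => by rw [dist_self]; exact hε 0) c).trans
    (e.trans (H 1 K' _ b h₁ d fun p => by rw [dist_self]; exact hε 1))

end

end QuasiIsotopy

theorem theorem1p3 (m k : ℕ) :
    (∀ h : unitInterval → QuasiIsotopy.Circles m → QuasiIsotopy.R3,
      QuasiIsotopy.IsTopIsotopy h →
      ∃ ε : ℝ, 0 < ε ∧ ∀ l : unitInterval → QuasiIsotopy.Circles m → QuasiIsotopy.R3,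
        QuasiIsotopy.IsGenericPLHomotopy l →
        (∀ t p, dist (l t p) (h t p) < ε) →
        QuasiIsotopy.IsStrongQuasiIsotopy k l) ∧
    (∀ L : QuasiIsotopy.Circles m → QuasiIsotopy.R3,
      QuasiIsotopy.IsTopLink L →
      ∃ ε : ℝ, 0 < ε ∧ ∀ L₀ L₁ : QuasiIsotopy.Circles m → QuasiIsotopy.R3,
        QuasiIsotopy.IsPLLink L₀ → QuasiIsotopy.IsPLLink L₁ →
        (∀ p, dist (L₀ p) (L p) < ε) → (∀ p, dist (L₁ p) (L p) < ε) →
        QuasiIsotopy.StronglyQuasiIsotopic k L₀ L₁) ∧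
    (∀ L₀ L₁ : QuasiIsotopy.Circles m → QuasiIsotopy.R3,
      QuasiIsotopy.IsPLLink L₀ → QuasiIsotopy.IsPLLink L₁ →
      QuasiIsotopy.TopIsotopic L₀ L₁ →
      QuasiIsotopy.StronglyQuasiIsotopic k L₀ L₁) := by
  refine ⟨fun h hh => ?_, fun L hL => ?_, fun L₀ L₁ h₀ h₁ h => ?_⟩
  · obtain ⟨ε, hε, H⟩ := hh.exists_forall_isStrongQuasiIsotopy k
    exact ⟨ε, hε, H⟩
  · obtain ⟨ε, hε, H⟩ := hL.exists_stronglyQuasiIsotopic k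
    exact ⟨ε, hε, fun L₀ L₁ h₀ h₁ => H L₀ L₁ h₀.isPolygonalLink h₁.isPolygonalLink⟩
  · exact h.stronglyQuasiIsotopic k h₀.isPolygonalLink h₁.isPolygonalLink
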